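/- Let $n>k$, let $x_{t-n+1},\dots,x_t\in\mathbb R^k$ be observed asset returns, modelled as independent $\mathcal N_k(\mu,\Sigma)$ vectors given $(\mu,\Sigma)$ with $\Sigma$ positive definite, and let $X_{t+1}\mid\mu,\Sigma\sim\mathcal N_k(\mu,\Sigma)$ be conditionally independent of them. Put $\bar x_t=\frac1n\sum_i x_i$, $S_t=\frac1{n-1}\sum_i (x_i-\bar x_t)(x_i-\bar x_t)^\top$ and $S_{t,d}=(n-1)S_t$. For a prior density $\pi(\mu,\Sigma)$, let the posterior be the normalization of $L(x\mid\mu,\Sigma)\,\pi(\mu,\Sigma)\,d\mu\,d\Sigma$, where $L$ is the likelihood and $d\Sigma=\prod_{i\le j}d\sigma_{ij}$ on positive definite matrices. For given weights $v_t\in\mathbb R^k$, current wealth $W_t\in\mathbb R$ and risk-free return $r_{f,t+1}\in\mathbb R$, let $\widehat W_{t+1}$ have the posterior predictive distribution of $W_{t+1}=W_t\big(1+r_{f,t+1}+v_t^\top(X_{t+1}-r_{f,t+1}\mathbf 1)\big)$, i.e. the mixture of the conditional laws of $W_{t+1}$ given $(\mu,\Sigma)$ over the posterior. Let $t_\delta$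 denote the standard Student $t$-distribution with $\delta$ degrees of freedom. (a) Under the diffuse prior $\pi(\mu,\Sigma)\propto|\Sigma|^{-(k+1)/2}$, if $S_{t,d}$ is positive definite, then the posterior is a proper probability distribution and $$\widehat W_{t+1}\stackrel d= W_t\Big(1+r_{f,t+1}+v_t^\top(\bar x_t-r_{f,t+1}\mathbf 1)+\sqrt{v_t^\top S_{t,d}v_t}\Big(\tfrac{t_1}{\sqrt{n(n-k)}}+\sqrt{1+\tfrac{t_1^2}{n-k}}\,\tfrac{t_2}{\sqrt{n-k+1}}\Big)\Big),$$ where $t_1\sim t_{n-k}$ and $t_2\sim t_{n-k+1}$ are independent. (b) Under the conjugate prior $\mu\mid\Sigma\sim\mathcal N_k(m_0,\Sigma/r_0)$, $\Sigma\sim\mathcal{IW}_k(d_0,S_0)$, with $m_0\in\mathbb R^k$, $r_0>0$, $d_0>2k$ and $S_0$ positive definite, where $\mathcal{IW}_k(d_0,S_0)$ is the inverse Wishart distribution with density proportional to $|\Sigma|^{-d_0/2}\exp(-\frac12\operatorname{tr}(\Sigma^{-1}S_0))$, the posterior is a proper probability distribution and $$\widehat W_{t+1}\stackrel d= W_t\Big(1+r_{f,t+1}+v_t^\top(\bar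 x_{t,c}-r_{f,t+1}\mathbf 1)+\sqrt{v_t^\top S_{t,c}v_t}\Big(\tfrac{t_1}{\sqrt{(n+r_0)(n+d_0-2k)}}+\sqrt{1+\tfrac{t_1^2}{n+d_0-2k}}\,\tfrac{t_2}{\sqrt{n+d_0-2k+1}}\Big)\Big),$$ where $\bar x_{t,c}=\frac{n\bar x_t+r_0m_0}{n+r_0}$, $S_{t,c}=S_{t,d}+S_0+\frac{nr_0}{n+r_0}(m_0-\bar x_t)(m_0-\bar x_t)^\top$, and $t_1\sim t_{n+d_0-2k}$ and $t_2\sim t_{n+d_0-2k+1}$ are independent. -/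

import Mathlib

open MeasureTheory ProbabilityTheory
open scoped Matrix ENNReal

noncomputable section

namespace BayesPortfolio

/-- The standard univariate Student `t`-distribution with `d` degrees of freedom: the law of
`Z / √(V / d)` with `Z ∼ N(0, 1)` and `V ∼ χ²_d = Gamma(d / 2, 1 / 2)` independent. -/
def studentT (d : ℝ) : Measure ℝ :=
  ((gaussianReal 0 1).prod (gammaMeasure (d / 2) (1 / 2))).map
    (fun p : ℝ × ℝ => p.1 / √(p.2 / d))

/-- Density (with respect to Lebesgue measure on `ℝᵏ`) of the `k`-dimensional normal distribution
`N_k(μ, Σ)`, for positive definite `Σ`. -/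
def normalDensity {k : ℕ} (μ : Fin k → ℝ) (Sg : Matrix (Fin k) (Fin k) ℝ) (y : Fin k → ℝ) : ℝ :=
  (2 * Real.pi) ^ (-(k : ℝ) / 2) * Sg.det ^ (-(1 : ℝ) / 2) *
    Real.exp (-(1 / 2) * ((y - μ) ⬝ᵥ (Sg⁻¹ *ᵥ (y - μ))))

/-- The normal distribution `N_k(μ, Σ)`, for positive definite `Σ`. -/
def normalLaw {k : ℕ} (μ : Fin k → ℝ) (Sg : Matrix (Fin k) (Fin k) ℝ) : Measure (Fin k → ℝ) :=
  volume.withDensity (fun y => ENNReal.ofReal (normalDensity μ Sg y))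

/-- The multivariate gamma function `Γ_k(a) = π^(k(k-1)/4) ∏_{i=1}^k Γ(a - (i-1)/2)`. -/
def multivariateGamma (k : ℕ) (a : ℝ) : ℝ :=
  Real.pi ^ ((k : ℝ) * ((k : ℝ) - 1) / 4) * ∏ i : Fin k, Real.Gamma (a - (i : ℝ) / 2)

/-- Density of the inverse Wishart distribution `IW_k(m, Ψ)` (with `m > 2k` and `Ψ` positive
definite), in the parametrization in which it is proportional to
`|Σ|^(-m/2) exp(-tr(Σ⁻¹ Ψ)/2)`, with respect to Lebesgue measure on symmetric matrices. -/
def invWishartDensity {k : ℕ} (m : ℝ) (Ps Sg : Matrix (Fin k) (Fin k) ℝ) : ℝ :=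
  (2 : ℝ) ^ (-((m - k - 1) * k / 2)) * Ps.det ^ ((m - k - 1) / 2) /
      multivariateGamma k ((m - k - 1) / 2) *
    Sg.det ^ (-m / 2) * Real.exp (-(1 / 2) * (Sg⁻¹ * Ps).trace)

/-- The sample mean. -/
def sampleMean {k n : ℕ} (x : Fin n → Fin k → ℝ) : Fin k → ℝ :=
  (n : ℝ)⁻¹ • ∑ i, x i

/-- The sample covariance matrix. -/
def sampleCov {k n : ℕ} (x : Fin n → Fin k → ℝ) : Matrix (Fin k) (Fin k) ℝ :=
  ((n : ℝ) - 1)⁻¹ • ∑ i, Matrix.vecMulVec (x i - sampleMean x) (x i - sampleMean x)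

/-- `S_{t,d} = (n - 1) S_t`. -/
def diffuseScale {k n : ℕ} (x : Fin n → Fin k → ℝ) : Matrix (Fin k) (Fin k) ℝ :=
  ((n : ℝ) - 1) • sampleCov x

/-- `x̄_{t,c} = (n x̄_t + r₀ m₀) / (n + r₀)`. -/
def conjugateMean {k n : ℕ} (x : Fin n → Fin k → ℝ) (m₀ : Fin k → ℝ) (r₀ : ℝ) : Fin k → ℝ :=
  ((n : ℝ) + r₀)⁻¹ • ((n : ℝ) • sampleMean x + r₀ • m₀)

/-- `S_{t,c} = S_{t,d} + S₀ + (n r₀ / (n + r₀)) (m₀ - x̄_t)(m₀ - x̄_t)ᵀ`. -/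
def conjugateScale {k n : ℕ} (x : Fin n → Fin k → ℝ) (m₀ : Fin k → ℝ) (r₀ : ℝ)
    (S₀ : Matrix (Fin k) (Fin k) ℝ) : Matrix (Fin k) (Fin k) ℝ :=
  diffuseScale x + S₀ +
    ((n : ℝ) * r₀ / ((n : ℝ) + r₀)) •
      Matrix.vecMulVec (m₀ - sampleMean x) (m₀ - sampleMean x)

/-- The symmetric matrix with given entries, one for each unordered pair of indices. -/
def symMatrix {k : ℕ} (s : Sym2 (Fin k) → ℝ) : Matrix (Fin k) (Fin k) ℝ :=
  Matrix.of fun i j => s s(i, j)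

/-- The pairs `(μ, Σ)`, with the symmetric matrix `Σ` given by its `k(k+1)/2` entries `σ_ij`,
`i ≤ j`. The volume is Lebesgue measure `dμ dΣ = ∏ dμ_i ∏_{i ≤ j} dσ_ij`. -/
abbrev Param (k : ℕ) : Type := (Fin k → ℝ) × (Sym2 (Fin k) → ℝ)

/-- The likelihood of `(μ, Σ)` for independent observations `x_i ∼ N_k(μ, Σ)`. -/
def likelihood {k n : ℕ} (x : Fin n → Fin k → ℝ) (μ : Fin k → ℝ)
    (Sg : Matrix (Fin k) (Fin k) ℝ) : ℝ :=
  ∏ i, normalDensity μ Sg (x i)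

/-- The diffuse (Jeffreys) prior `π(μ, Σ) ∝ |Σ|^(-(k+1)/2)`. -/
def diffusePrior {k : ℕ} (_μ : Fin k → ℝ) (Sg : Matrix (Fin k) (Fin k) ℝ) : ℝ :=
  Sg.det ^ (-((k : ℝ) + 1) / 2)

/-- Density of the conjugate prior `μ | Σ ∼ N_k(m₀, Σ / r₀)`, `Σ ∼ IW_k(d₀, S₀)`. -/
def conjugatePrior {k : ℕ} (m₀ : Fin k → ℝ) (r₀ d₀ : ℝ) (S₀ : Matrix (Fin k) (Fin k) ℝ)
    (μ : Fin k → ℝ) (Sg : Matrix (Fin k) (Fin k) ℝ) : ℝ :=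
  normalDensity m₀ (r₀⁻¹ • Sg) μ * invWishartDensity d₀ S₀ Sg

/-- The measure `L(x | μ, Σ) π(μ, Σ) dμ dΣ` on the set of `(μ, Σ)` with `Σ` positive definite. -/
def unnormalizedPosterior {k n : ℕ} (x : Fin n → Fin k → ℝ)
    (prior : (Fin k → ℝ) → Matrix (Fin k) (Fin k) ℝ → ℝ) : Measure (Param k) :=
  (volume.restrict {θ : Param k | (symMatrix θ.2).PosDef}).withDensity
    (fun θ => ENNReal.ofReal
      (likelihood x θ.1 (symMatrix θ.2) * prior θ.1 (symMatrix θ.2)))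

/-- The posterior distribution of `(μ, Σ)` given the data `x`: the normalization of
`L(x | μ, Σ) π(μ, Σ) dμ dΣ`. It is a probability measure if and only if the total mass of the
latter is neither `0` nor `∞`. -/
def posterior {k n : ℕ} (x : Fin n → Fin k → ℝ)
    (prior : (Fin k → ℝ) → Matrix (Fin k) (Fin k) ℝ → ℝ) : Measure (Param k) :=
  (unnormalizedPosterior x prior Set.univ)⁻¹ • unnormalizedPosterior x prior

/-- The wealth `W_{t+1} = W_t (1 + r_f + vᵀ (X_{t+1} - r_f 1))`. -/
def wealth {k : ℕ} (W rf : ℝ) (v X : Fin k → ℝ) : ℝ :=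
  W * (1 + rf + v ⬝ᵥ (X - fun _ => rf))

/-- The conditional law of `W_{t+1}` given `(μ, Σ)`, for `X_{t+1} | μ, Σ ∼ N_k(μ, Σ)`. -/
def wealthLaw {k : ℕ} (W rf : ℝ) (v : Fin k → ℝ) (θ : Param k) : Measure ℝ :=
  (normalLaw θ.1 (symMatrix θ.2)).map (wealth W rf v)

lemma measurable_normalDensity {k : ℕ} :
    Measurable (fun p : Param k × (Fin k → ℝ) =>
      normalDensity p.1.1 (symMatrix p.1.2) p.2) := by
  have hc : Continuous (fun p : Param k × (Fin k → ℝ) => symMatrix p.1.2) := by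
    refine continuous_matrix fun i j => ?_
    simp only [symMatrix, Matrix.of_apply]
    fun_prop
  have hdet : Measurable (fun p : Param k × (Fin k → ℝ) => (symMatrix p.1.2).det) :=
    hc.matrix_det.measurable
  have hinv : ∀ i j, Measurable
      (fun p : Param k × (Fin k → ℝ) => (symMatrix p.1.2)⁻¹ i j) := by
    intro i j
    simp only [Matrix.inv_def, Ring.inverse_eq_inv', Matrix.smul_apply, smul_eq_mul]
    exact hdet.inv.mul ((hc.matrix_adjugate.matrix_elem i j).measurable)
  unfold normalDensity
  simp only [dotProduct, Matrix.mulVec]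
  refine ((measurable_const.mul (hdet.pow_const _)).mul (Real.measurable_exp.comp ?_))
  refine measurable_const.mul (Finset.measurable_sum _ fun i _ => ?_)
  refine Measurable.mul (by fun_prop) (Finset.measurable_sum _ fun j _ => ?_)
  exact (hinv i j).mul (by fun_prop)

/-- The conditional law of the wealth is a measurable function of `(μ, Σ)`, so that the mixture
below is the intended one. -/
lemma measurable_wealthLaw {k : ℕ} (W rf : ℝ) (v : Fin k → ℝ) :
    Measurable (wealthLaw W rf v) := by
  have hw : Measurable (wealth W rf v) := by
    unfold wealth dotProduct
    fun_prop
  have hn : Measurable (fun θ : Param k => normalLaw θ.1 (symMatrix θ.2)) := by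
    refine Measure.measurable_of_measurable_coe _ fun s hs => ?_
    simp only [normalLaw, withDensity_apply _ hs]
    exact Measurable.lintegral_prod_right measurable_normalDensity.ennreal_ofReal
  exact (Measure.measurable_map _ hw).comp hn

/-- The posterior predictive distribution of the wealth `W_{t+1}` given the data `x`: the mixture
of the conditional laws of `W_{t+1}` given `(μ, Σ)` over the posterior of `(μ, Σ)`. -/
def predictiveWealth {k n : ℕ} (x : Fin n → Fin k → ℝ)
    (prior : (Fin k → ℝ) → Matrix (Fin k) (Fin k) ℝ → ℝ) (W rf : ℝ) (v : Fin k → ℝ) :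
    Measure ℝ :=
  (posterior x prior).bind (wealthLaw W rf v)

end BayesPortfolio

end

namespace BayesPortfolio

/-! ### Matrix factorizations -/

/-! For both priors, likelihood times prior is a constant times a normal-inverse-Wishart density:
the kernel `|Σ|^(-m/2) exp(-tr(Σ⁻¹ S)/2)` times the density of `N(c, Σ/r)` at `μ`. The diffuse prior
gives `m = n + k`, `r = n`, `c = x̄`, `S = S_d`; the conjugate prior gives `m = n + d₀`, `r = n +
r₀` and, by completing the square, `c = x̄_c`, `S = S_c`. The rest is proved once for this form.

Given `Σ`, the mean return `vᵀμ` is normal with variance `vᵀΣv / r`, and given `(μ, Σ)` the return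
`vᵀX` is normal with variance `vᵀΣv`. So the predictive law needs only the posterior law of the
scalar `vᵀΣv`, which is that of `vᵀSv / u` with `u` chi-squared with `d = m - 2k` degrees of freedom
(`lintegral_quadForm_invWishartMeasure`). To see this, write `S = A Aᵀ` with `Aᵀv` a multiple of the
first basis vector. The congruence by `A` reduces to `S = 1` and to the entry `σ = Σ₁₁`. In Schur
coordinates `(σ, D, b)` the kernel splits into an inverse gamma density in `σ`, a kernel of the same
kind in the smaller matrix `D`, and a normal density in `b`, which integrates to one
(`invWishartKernel_symBlock`). By induction the same splitting shows that the total mass is finite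
and nonzero, so the posterior is proper. Jacobians and normalizing constants stay unevaluated, since
they cancel on normalization.

The return is thus `vᵀc + √(vᵀSv) (y/√(ru) + z/√u)` with `y`, `z` standard normal and `u`
independent. Here `t₁ = √d y/√u` is Student with `d` degrees of freedom, and given `t₁` the variable
`u` is gamma with shape `(d+1)/2` and rate `(1 + t₁²/d)/2`. Hence `z/√u` is `√(1 + t₁²/d) t₂/√(d+1)`
with `t₂` Student with `d + 1` degrees of freedom, independent of `t₁`
(`lintegral_gammaMeasure_gaussianReal_eq_studentT`). Equalities of laws are tested on nonnegative
measurable functions. -/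

open scoped MatrixOrder in
lemma exists_mul_transpose_eq {k : ℕ} {S : Matrix (Fin k) (Fin k) ℝ} (hS : S.PosDef) :
    ∃ A : Matrix (Fin k) (Fin k) ℝ, A * Aᵀ = S := by
  refine ⟨CFC.sqrt S, ?_⟩
  rw [← Matrix.conjTranspose_eq_transpose_of_trivial,
    (Matrix.nonneg_iff_posSemidef.mp (CFC.sqrt_nonneg S)).isHermitian.eq, ← pow_two,
    CFC.sq_sqrt S hS.posSemidef.nonneg]

/-- The columns of `O` are an orthonormal basis extending `w / ‖w‖`; for `w = 0` any orthonormal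
basis works. -/
lemma exists_orthogonal_vecMul {k : ℕ} (w : Fin (k + 1) → ℝ) :
    ∃ O : Matrix (Fin (k + 1)) (Fin (k + 1)) ℝ, O * Oᵀ = 1 ∧ w ᵥ* O = Pi.single 0 √(w ⬝ᵥ w) := by
  let u : EuclideanSpace ℝ (Fin (k + 1)) := WithLp.toLp 2 w
  have hinner : ∀ x y : EuclideanSpace ℝ (Fin (k + 1)), inner ℝ x y = ∑ i, x i * y i := by
    intro x y
    simp [PiLp.inner_apply, mul_comm]
  have hnorm : √(w ⬝ᵥ w) = ‖u‖ := by
    rw [norm_eq_sqrt_real_inner, hinner]; rfl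
  obtain ⟨b, hb⟩ : ∃ b : OrthonormalBasis (Fin (k + 1)) ℝ (EuclideanSpace ℝ (Fin (k + 1))),
      u = ‖u‖ • b 0 := by
    by_cases hu : u = 0
    · exact ⟨EuclideanSpace.basisFun _ ℝ, by simp [hu]⟩
    · have hv : Orthonormal ℝ (({0} : Set (Fin (k + 1))).domRestrict fun _ => ‖u‖⁻¹ • u) := by
        refine ⟨fun i => ?_, fun i j hij => (hij (Subsingleton.elim i j)).elim⟩
        simp [norm_smul, norm_ne_zero_iff.mpr hu]
      obtain ⟨b, hb⟩ := hv.exists_orthonormalBasis_extension_of_card_eq (by simp)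
      refine ⟨b, ?_⟩
      rw [hb 0 rfl, smul_smul, mul_inv_cancel₀ (norm_ne_zero_iff.mpr hu), one_smul]
  refine ⟨Matrix.of fun i j => b j i, ?_, ?_⟩
  · rw [mul_eq_one_comm]
    ext i j
    rw [Matrix.mul_apply]
    have := b.inner_eq_ite i j
    rw [hinner] at this
    simpa [Matrix.one_apply] using this
  · ext j
    have h1 : (w ᵥ* Matrix.of fun i j => b j i) j = inner ℝ u (b j) := by
      rw [hinner]; rfl
    rw [h1, hnorm, hb, inner_smul_left, b.inner_eq_ite, norm_smul, b.norm_eq_one]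
    by_cases h : j = 0
    · simp [h]
    · simp [h, Ne.symm h]

/-- A positive definite matrix has a factorization `S = A Aᵀ` in which `Aᵀ v` is a multiple of the
first basis vector. -/
lemma exists_mul_transpose_eq_vecMul {k : ℕ} {S : Matrix (Fin (k + 1)) (Fin (k + 1)) ℝ}
    (hS : S.PosDef) (v : Fin (k + 1) → ℝ) :
    ∃ A : Matrix (Fin (k + 1)) (Fin (k + 1)) ℝ, A * Aᵀ = S ∧
      v ᵥ* A = Pi.single 0 √(v ⬝ᵥ (S *ᵥ v)) := by
  obtain ⟨B, hB⟩ := exists_mul_transpose_eq hS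
  obtain ⟨O, hO, hw⟩ := exists_orthogonal_vecMul (v ᵥ* B)
  refine ⟨B * O, ?_, ?_⟩
  · rw [Matrix.transpose_mul, Matrix.mul_assoc, ← Matrix.mul_assoc O, hO, Matrix.one_mul, hB]
  · rw [← Matrix.vecMul_vecMul, hw, ← hB, ← Matrix.mulVec_mulVec, Matrix.dotProduct_mulVec,
      Matrix.mulVec_transpose]

lemma det_ne_zero_of_mul_transpose {k : ℕ} {A S : Matrix (Fin k) (Fin k) ℝ} (hS : S.PosDef)
    (h : A * Aᵀ = S) : A.det ≠ 0 := by
  intro h0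
  have := hS.det_pos
  rw [← h, Matrix.det_mul, h0, zero_mul] at this
  exact this.false

/-! ### The multivariate normal distribution -/

lemma lintegral_pi_prod {n : ℕ} (μ : Fin n → Measure ℝ) [∀ i, SigmaFinite (μ i)]
    (f : Fin n → ℝ → ℝ≥0∞) (hf : ∀ i, Measurable (f i)) :
    ∫⁻ x, ∏ i, f i (x i) ∂(Measure.pi μ) = ∏ i, ∫⁻ y, f i y ∂(μ i) := by
  induction n with
  | zero => simp
  | succ n ih =>
    have e := (measurePreserving_piFinSuccAbove μ 0).symm
    rw [← e.lintegral_comp_emb (MeasurableEquiv.measurableEmbedding _)]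
    simp only [Fin.prod_univ_succ]
    simp only [MeasurableEquiv.piFinSuccAbove_symm_apply, Fin.insertNthEquiv_zero,
      Fin.consEquiv_apply, Fin.cons_zero, Fin.cons_succ, Fin.zero_succAbove]
    rw [lintegral_prod_mul (f := f 0) (g := fun x : Fin n → ℝ => ∏ i, f i.succ (x i))
      (hf 0).aemeasurable
      (Finset.measurable_prod _ fun i _ => (hf i.succ).comp (measurable_pi_apply i)).aemeasurable, ih _ _ fun i => hf i.succ]

lemma pi_gaussianReal_eq_withDensity (n : ℕ) :
    Measure.pi (fun _ : Fin n => gaussianReal 0 1) =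
      volume.withDensity (fun z => ∏ i, gaussianPDF 0 1 (z i)) := by
  refine (Measure.pi_eq fun s hs => ?_)
  rw [withDensity_apply _ (MeasurableSet.univ_pi hs), volume_pi, Measure.restrict_pi_pi,
    lintegral_pi_prod _ _ fun _ => measurable_gaussianPDF 0 1]
  simp_rw [gaussianReal_apply 0 one_ne_zero]

lemma prod_gaussianPDF {n : ℕ} (z : Fin n → ℝ) :
    ∏ i, gaussianPDF 0 1 (z i) =
      ENNReal.ofReal ((2 * Real.pi) ^ (-(n : ℝ) / 2) * Real.exp (-(1 / 2) * (z ⬝ᵥ z))) := by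
  simp only [gaussianPDF]
  rw [← ENNReal.ofReal_prod_of_nonneg fun i _ => gaussianPDFReal_nonneg _ _ _]
  congr 1
  simp only [gaussianPDFReal, Finset.prod_mul_distrib, ← Real.exp_sum, Finset.prod_const,
    Finset.card_univ, Fintype.card_fin, dotProduct, Finset.mul_sum]
  congr 1
  · rw [NNReal.coe_one, mul_one, Real.sqrt_eq_rpow, ← Real.rpow_neg (by positivity),
      ← Real.rpow_natCast, ← Real.rpow_mul (by positivity)]
    congr 1; ring
  · congr 1
    refine Finset.sum_congr rfl fun i _ => ?_
    simp; ring

lemma normalDensity_mul_transpose {k : ℕ} (μ z : Fin k → ℝ) {A : Matrix (Fin k) (Fin k) ℝ}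
    (hA : A.det ≠ 0) :
    normalDensity μ (A * Aᵀ) (μ + A *ᵥ z) =
      |A.det|⁻¹ * ((2 * Real.pi) ^ (-(k : ℝ) / 2) * Real.exp (-(1 / 2) * (z ⬝ᵥ z))) := by
  have h1 : (A * Aᵀ).det ^ (-(1 : ℝ) / 2) = |A.det|⁻¹ := by
    rw [Matrix.det_mul, Matrix.det_transpose, ← abs_mul_abs_self, ← pow_two,
      ← Real.rpow_natCast, ← Real.rpow_mul (abs_nonneg _)]
    norm_num [Real.rpow_neg_one]
  have hu : IsUnit A.det := isUnit_iff_ne_zero.mpr hA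
  have h2 : (A *ᵥ z) ⬝ᵥ ((A * Aᵀ)⁻¹ *ᵥ (A *ᵥ z)) = z ⬝ᵥ z := by
    rw [Matrix.mul_inv_rev, Matrix.mulVec_mulVec, Matrix.mul_assoc, Matrix.nonsing_inv_mul _ hu,
      Matrix.mul_one, Matrix.dotProduct_mulVec, ← Matrix.transpose_nonsing_inv,
      Matrix.vecMul_transpose, Matrix.mulVec_mulVec, Matrix.nonsing_inv_mul _ hu,
      Matrix.one_mulVec]
  rw [normalDensity, h1, add_sub_cancel_left, h2]
  ring

lemma measurable_normalDensity_right {k : ℕ} (μ : Fin k → ℝ) (S : Matrix (Fin k) (Fin k) ℝ) :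
    Measurable (normalDensity μ S) := by
  unfold normalDensity dotProduct Matrix.mulVec dotProduct
  fun_prop

/-- Substituting `y = μ + A z` turns the density into the standard Gaussian one, its factor `|det
A|⁻¹` cancelling the Jacobian. Any factor `A` of the covariance is allowed, and this freedom is what
later aligns `v` with a coordinate axis. -/
lemma lintegral_normalLaw {k : ℕ} (μ : Fin k → ℝ) {A : Matrix (Fin k) (Fin k) ℝ}
    (hA : A.det ≠ 0) {F : (Fin k → ℝ) → ℝ≥0∞} (hF : Measurable F) :
    ∫⁻ y, F y ∂(normalLaw μ (A * Aᵀ)) =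
      ∫⁻ z, F (μ + A *ᵥ z) ∂(Measure.pi fun _ => gaussianReal 0 1) := by
  have hmd := measurable_normalDensity_right μ (A * Aᵀ)
  have hd : Measurable fun y => ENNReal.ofReal (normalDensity μ (A * Aᵀ) y) * F y :=
    hmd.ennreal_ofReal.mul hF
  have hdet : ENNReal.ofReal |A.det| ≠ 0 := by simpa using hA
  have hmap : (volume : Measure (Fin k → ℝ)) =
      ENNReal.ofReal |A.det| • Measure.map (Matrix.toLin' A) volume := by
    rw [Real.map_matrix_volume_pi_eq_smul_volume_pi hA, smul_smul, abs_inv,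
      ENNReal.ofReal_inv_of_pos (by positivity), ENNReal.mul_inv_cancel hdet (by simp), one_smul]
  have hφ : Measurable fun z : Fin k → ℝ => ∏ i, gaussianPDF 0 1 (z i) :=
    Finset.measurable_prod _ fun i _ => (measurable_gaussianPDF 0 1).comp (measurable_pi_apply i)
  have hFA : Measurable fun z => F (μ + A *ᵥ z) :=
    hF.comp (by unfold Matrix.mulVec dotProduct; fun_prop)
  rw [normalLaw, lintegral_withDensity_eq_lintegral_mul _ hmd.ennreal_ofReal hF,
    pi_gaussianReal_eq_withDensity, lintegral_withDensity_eq_lintegral_mul _ hφ hFA]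
  simp only [Pi.mul_apply]
  rw [← lintegral_add_left_eq_self _ μ]
  nth_rewrite 1 [hmap]
  have hA' : Measurable (Matrix.toLin' A) := (LinearMap.continuous_on_pi _).measurable
  have hd' : Measurable fun y =>
      ENNReal.ofReal (normalDensity μ (A * Aᵀ) (μ + y)) * F (μ + y) :=
    hd.comp (measurable_const_add μ)
  rw [lintegral_smul_measure, lintegral_map hd' hA', smul_eq_mul,
    ← lintegral_const_mul' _ _ ENNReal.ofReal_ne_top]
  refine lintegral_congr fun z => ?_
  rw [Matrix.toLin'_apply, normalDensity_mul_transpose μ z hA, prod_gaussianPDF, ← mul_assoc,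
    ← ENNReal.ofReal_mul (abs_nonneg _), ← mul_assoc, mul_inv_cancel₀ (abs_ne_zero.mpr hA),
    one_mul]

lemma isProbabilityMeasure_normalLaw {k : ℕ} (μ : Fin k → ℝ) {S : Matrix (Fin k) (Fin k) ℝ}
    (hS : S.PosDef) : IsProbabilityMeasure (normalLaw μ S) := by
  obtain ⟨A, hA⟩ := exists_mul_transpose_eq hS
  have hdet := det_ne_zero_of_mul_transpose hS hA
  constructor
  rw [← hA, ← lintegral_one, lintegral_normalLaw μ hdet measurable_const]
  simp

/-- Linear functionals of a normal vector are normal. -/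
lemma lintegral_dotProduct_normalLaw {k : ℕ} (v μ : Fin k → ℝ) {S : Matrix (Fin k) (Fin k) ℝ}
    (hS : S.PosDef) {F : ℝ → ℝ≥0∞} (hF : Measurable F) :
    ∫⁻ y, F (v ⬝ᵥ y) ∂(normalLaw μ S) =
      ∫⁻ z, F (v ⬝ᵥ μ + √(v ⬝ᵥ (S *ᵥ v)) * z) ∂(gaussianReal 0 1) := by
  cases k with
  -- In dimension zero there is no first coordinate, but both integrands are the constant `F 0` and
  -- both laws have mass one.
  | zero =>
    have := isProbabilityMeasure_normalLaw μ hS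
    simp
  | succ k =>
    obtain ⟨A, hA, hv⟩ := exists_mul_transpose_eq_vecMul hS v
    have hdet := det_ne_zero_of_mul_transpose hS hA
    nth_rewrite 1 [← hA]
    have hFv : Measurable fun y => F (v ⬝ᵥ y) := hF.comp (by unfold dotProduct; fun_prop)
    rw [lintegral_normalLaw μ hdet hFv]
    have hFs : Measurable fun z => F (v ⬝ᵥ μ + √(v ⬝ᵥ (S *ᵥ v)) * z) := hF.comp (by fun_prop)
    rw [← (measurePreserving_eval (fun _ : Fin (k + 1) => gaussianReal 0 1) 0).lintegral_comp hFs]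
    refine lintegral_congr fun z => ?_
    rw [dotProduct_add, Matrix.dotProduct_mulVec v A, hv, single_dotProduct]

/-! ### Lebesgue measure on symmetric matrices -/

/-- An additive Haar measure is, up to a factor, the image of any other one under a linear
isomorphism. -/
lemma exists_lintegral_comp_linearEquiv {E G : Type*}
    [NormedAddCommGroup E] [NormedSpace ℝ E] [FiniteDimensional ℝ E] [MeasurableSpace E]
    [BorelSpace E] [NormedAddCommGroup G] [NormedSpace ℝ G] [FiniteDimensional ℝ G]
    [MeasurableSpace G] [BorelSpace G] (μ : Measure E) (ν : Measure G) [μ.IsAddHaarMeasure]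
    [ν.IsAddHaarMeasure] (e : E ≃ₗ[ℝ] G) :
    ∃ c : ℝ≥0∞, c ≠ 0 ∧ c ≠ ∞ ∧ ∀ f : G → ℝ≥0∞, ∫⁻ y, f y ∂ν = c * ∫⁻ x, f (e x) ∂μ := by
  let e' := e.toContinuousLinearEquiv
  have : (μ.map e').IsAddHaarMeasure := e'.isAddHaarMeasure_map μ
  refine ⟨Measure.addHaarScalarFactor ν (μ.map e'), ?_, ENNReal.coe_ne_top, fun f => ?_⟩
  · exact_mod_cast (Measure.addHaarScalarFactor_pos_of_isAddHaarMeasure ν (μ.map e')).ne'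
  · nth_rewrite 1 [Measure.isAddLeftInvariant_eq_smul ν (μ.map e')]
    rw [lintegral_smul_measure, ENNReal.smul_def, smul_eq_mul]
    congr 1
    exact lintegral_map_equiv f e'.toHomeomorph.toMeasurableEquiv

variable {k : ℕ}

lemma symMatrix_injective : Function.Injective (symMatrix (k := k)) := by
  intro s t h
  ext z
  induction z with
  | _ i j => exact congrFun (congrFun h i) j

lemma transpose_symMatrix (s : Sym2 (Fin k) → ℝ) : (symMatrix s)ᵀ = symMatrix s := by
  ext i j
  simp [symMatrix, Sym2.eq_swap]

lemma continuous_symMatrix : Continuous (symMatrix (k := k)) :=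
  continuous_matrix fun i j => continuous_apply s(i, j)

lemma measurable_quadForm (v : Fin k → ℝ) :
    Measurable fun s : Sym2 (Fin k) → ℝ => v ⬝ᵥ (symMatrix s *ᵥ v) := by
  have := continuous_symMatrix (k := k)
  exact (by fun_prop : Continuous _).measurable

/-- The set of parameters of positive definite symmetric matrices. -/
def posDefSet (k : ℕ) : Set (Sym2 (Fin k) → ℝ) := {s | (symMatrix s).PosDef}

/-- Positive definite means positive semidefinite, a closed condition, with nonzero determinant, an
open one. -/
lemma measurableSet_posDefSet : MeasurableSet (posDefSet k) := by
  have h : posDefSet k =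
      (⋂ x : Fin k → ℝ, {s | 0 ≤ x ⬝ᵥ (symMatrix s *ᵥ x)}) ∩ {s | (symMatrix s).det ≠ 0} := by
    ext s
    simp only [posDefSet, Set.mem_ofPred_eq, Set.mem_inter_iff, Set.mem_iInter]
    constructor
    · exact fun h => ⟨fun x => by simpa using h.posSemidef.dotProduct_mulVec_nonneg x,
        h.det_pos.ne'⟩
    · rintro ⟨h1, h2⟩
      have : (symMatrix s).PosSemidef := .of_dotProduct_mulVec_nonneg
        (by rw [Matrix.IsHermitian, Matrix.conjTranspose_eq_transpose_of_trivial,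
              transpose_symMatrix]) (by simpa using h1)
      exact this.posDef_iff_det_ne_zero.mpr h2
  rw [h]
  have hc := continuous_symMatrix (k := k)
  refine MeasurableSet.inter (IsClosed.measurableSet (isClosed_iInter fun x => ?_))
    (isOpen_ne_fun hc.matrix_det continuous_const).measurableSet
  exact isClosed_le continuous_const (by fun_prop)

/-- The unnormalized inverse Wishart density `|Σ|^(-m/2) exp(-tr(Σ⁻¹ Ψ)/2)`. -/
noncomputable def invWishartKernel (m : ℝ) (Ps Sg : Matrix (Fin k) (Fin k) ℝ) : ℝ :=
  Sg.det ^ (-m / 2) * Real.exp (-(1 / 2) * (Sg⁻¹ * Ps).trace)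

/-- The measure with density `invWishartKernel` on the positive definite matrices. -/
noncomputable def invWishartMeasure (m : ℝ) (Ps : Matrix (Fin k) (Fin k) ℝ) :
    Measure (Sym2 (Fin k) → ℝ) :=
  (volume.restrict (posDefSet k)).withDensity
    fun s => ENNReal.ofReal (invWishartKernel m Ps (symMatrix s))

lemma measurable_invWishartKernel (m : ℝ) (Ps : Matrix (Fin k) (Fin k) ℝ) :
    Measurable fun s => invWishartKernel m Ps (symMatrix s) := by
  have hc := continuous_symMatrix (k := k)
  have hinv : ∀ i j, Measurable fun s : Sym2 (Fin k) → ℝ => (symMatrix s)⁻¹ i j := by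
    intro i j
    simp only [Matrix.inv_def, Ring.inverse_eq_inv', Matrix.smul_apply, smul_eq_mul]
    exact hc.matrix_det.measurable.inv.mul ((hc.matrix_adjugate.matrix_elem i j).measurable)
  unfold invWishartKernel
  refine (hc.matrix_det.measurable.pow_const _).mul (Real.measurable_exp.comp ?_)
  simp only [Matrix.trace, Matrix.diag_apply, Matrix.mul_apply]
  exact measurable_const.mul (Finset.measurable_sum _ fun i _ =>
    Finset.measurable_sum _ fun j _ => (hinv i j).mul_const _)

lemma lintegral_invWishartMeasure (m : ℝ) (Ps : Matrix (Fin k) (Fin k) ℝ)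
    {F : (Sym2 (Fin k) → ℝ) → ℝ≥0∞} (hF : Measurable F) :
    ∫⁻ s, F s ∂(invWishartMeasure m Ps) =
      ∫⁻ s, (posDefSet k).indicator
        (fun s => ENNReal.ofReal (invWishartKernel m Ps (symMatrix s)) * F s) s := by
  rw [invWishartMeasure, lintegral_withDensity_eq_lintegral_mul _
    (measurable_invWishartKernel m Ps).ennreal_ofReal hF,
    lintegral_indicator measurableSet_posDefSet]
  rfl

/-! ### Congruence transformations -/

lemma symMatrix_add (s t : Sym2 (Fin k) → ℝ) : symMatrix (s + t) = symMatrix s + symMatrix t := rfl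

lemma symMatrix_smul (c : ℝ) (s : Sym2 (Fin k) → ℝ) : symMatrix (c • s) = c • symMatrix s := rfl

/-- The congruence `Σ ↦ A Σ Aᵀ` on symmetric matrices. -/
def symConj (A : Matrix (Fin k) (Fin k) ℝ) : (Sym2 (Fin k) → ℝ) →ₗ[ℝ] (Sym2 (Fin k) → ℝ) where
  toFun s := Sym2.lift ⟨fun i j => (A * symMatrix s * Aᵀ) i j, fun i j => by
    have : (A * symMatrix s * Aᵀ)ᵀ = A * symMatrix s * Aᵀ := by
      simp [Matrix.transpose_mul, transpose_symMatrix, Matrix.mul_assoc]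
    exact congrFun (congrFun this j) i⟩
  map_add' s t := by
    ext z
    induction z with
    | _ i j => simp [symMatrix_add, Matrix.mul_add, Matrix.add_mul]
  map_smul' c s := by
    ext z
    induction z with
    | _ i j => simp [symMatrix_smul]

lemma symMatrix_symConj (A : Matrix (Fin k) (Fin k) ℝ) (s : Sym2 (Fin k) → ℝ) :
    symMatrix (symConj A s) = A * symMatrix s * Aᵀ := rfl

lemma symConj_symConj (A B : Matrix (Fin k) (Fin k) ℝ) (s : Sym2 (Fin k) → ℝ) :
    symConj A (symConj B s) = symConj (A * B) s := by
  apply symMatrix_injective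
  simp [symMatrix_symConj, Matrix.transpose_mul, Matrix.mul_assoc]

lemma symConj_one (s : Sym2 (Fin k) → ℝ) : symConj 1 s = s := by
  apply symMatrix_injective
  simp [symMatrix_symConj]

/-- The congruence by an invertible matrix, as a linear equivalence. -/
noncomputable def symConjEquiv {A : Matrix (Fin k) (Fin k) ℝ} (hA : A.det ≠ 0) :
    (Sym2 (Fin k) → ℝ) ≃ₗ[ℝ] (Sym2 (Fin k) → ℝ) :=
  LinearEquiv.ofLinearMap (symConj A) (symConj A⁻¹)
    (LinearMap.ext fun s => by
      simp [symConj_symConj, symConj_one, Matrix.mul_nonsing_inv _ (isUnit_iff_ne_zero.mpr hA)])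
    (LinearMap.ext fun s => by
      simp [symConj_symConj, symConj_one, Matrix.nonsing_inv_mul _ (isUnit_iff_ne_zero.mpr hA)])

lemma symConj_mem_posDefSet {A : Matrix (Fin k) (Fin k) ℝ} (hA : A.det ≠ 0)
    (s : Sym2 (Fin k) → ℝ) : symConj A s ∈ posDefSet k ↔ s ∈ posDefSet k := by
  have hu : IsUnit A := (Matrix.isUnit_iff_isUnit_det A).mpr (isUnit_iff_ne_zero.mpr hA)
  simp only [posDefSet, Set.mem_ofPred_eq, symMatrix_symConj]
  have := Matrix.IsUnit.posDef_star_right_conjugate_iff (x := symMatrix s) hu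
  rwa [Matrix.star_eq_conjTranspose, Matrix.conjTranspose_eq_transpose_of_trivial] at this

/-- `(A Σ Aᵀ)⁻¹ A Aᵀ` is similar to `Σ⁻¹`, so the trace does not change and only the determinant
contributes a factor. -/
lemma invWishartKernel_symConj (m : ℝ) {A : Matrix (Fin k) (Fin k) ℝ} (hA : A.det ≠ 0)
    {s : Sym2 (Fin k) → ℝ} (hs : s ∈ posDefSet k) :
    invWishartKernel m (A * Aᵀ) (symMatrix (symConj A s)) =
      (A.det ^ 2) ^ (-m / 2) * invWishartKernel m 1 (symMatrix s) := by
  have hu : IsUnit A.det := isUnit_iff_ne_zero.mpr hA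
  have h1 : ((A * symMatrix s * Aᵀ)⁻¹ * (A * Aᵀ)).trace = ((symMatrix s)⁻¹ * 1).trace := by
    rw [Matrix.mul_inv_rev, Matrix.mul_inv_rev, Matrix.trace_mul_comm, Matrix.mul_assoc A,
      ← Matrix.mul_assoc Aᵀ, Matrix.mul_nonsing_inv _ (by rwa [Matrix.det_transpose]),
      Matrix.one_mul, Matrix.trace_mul_comm, Matrix.mul_assoc, Matrix.nonsing_inv_mul _ hu]
  have h2 : (A * symMatrix s * Aᵀ).det = A.det ^ 2 * (symMatrix s).det := by
    rw [Matrix.det_mul, Matrix.det_mul, Matrix.det_transpose]; ring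
  rw [invWishartKernel, symMatrix_symConj, h1, h2,
    Real.mul_rpow (sq_nonneg _) (Matrix.PosDef.det_pos hs).le, invWishartKernel, mul_assoc]

/-- The congruence is linear and preserves positive definiteness, so its Jacobian is a constant. It
suffices that `c` is independent of `F`, nonzero and finite. -/
lemma exists_lintegral_invWishartMeasure_symConj (m : ℝ) {A : Matrix (Fin k) (Fin k) ℝ}
    (hA : A.det ≠ 0) :
    ∃ c : ℝ≥0∞, c ≠ 0 ∧ c ≠ ∞ ∧ ∀ F : (Sym2 (Fin k) → ℝ) → ℝ≥0∞, Measurable F →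
      ∫⁻ s, F s ∂(invWishartMeasure m (A * Aᵀ)) =
        c * ∫⁻ s, F (symConj A s) ∂(invWishartMeasure m 1) := by
  obtain ⟨c, hc0, hct, hc⟩ := exists_lintegral_comp_linearEquiv
    (volume : Measure (Sym2 (Fin k) → ℝ)) volume (symConjEquiv hA)
  have hpos : 0 < (A.det ^ 2) ^ (-m / 2) := by positivity
  refine ⟨c * ENNReal.ofReal ((A.det ^ 2) ^ (-m / 2)), mul_ne_zero hc0 (by simpa using hpos),
    ENNReal.mul_ne_top hct ENNReal.ofReal_ne_top, fun F hF => ?_⟩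
  have hconj : Measurable (symConj A) := (LinearMap.continuous_on_pi _).measurable
  have hFc : Measurable fun s => F (symConj A s) := hF.comp hconj
  rw [lintegral_invWishartMeasure m _ hF, lintegral_invWishartMeasure m _ hFc, hc,
    mul_assoc, ← lintegral_const_mul' _ _ ENNReal.ofReal_ne_top]
  congr 1
  refine lintegral_congr fun s => ?_
  change Set.indicator _ _ (symConj A s) = _
  by_cases hs : s ∈ posDefSet k
  · rw [Set.indicator_of_mem ((symConj_mem_posDefSet hA s).mpr hs), Set.indicator_of_mem hs,
      invWishartKernel_symConj m hA hs, ENNReal.ofReal_mul hpos.le, mul_assoc]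
  · rw [Set.indicator_of_notMem (mt (symConj_mem_posDefSet hA s).mp hs),
      Set.indicator_of_notMem hs, mul_zero]

/-! ### Schur complements -/

/-- A real number as a one by one matrix. -/
noncomputable abbrev scalarBlock (σ : ℝ) : Matrix Unit Unit ℝ := Matrix.diagonal fun _ => σ

/-- The block matrix with upper left entry `σ`, first column `b` below it, and Schur complement
`D`. -/
noncomputable def schurBlock (σ : ℝ) (D : Matrix (Fin k) (Fin k) ℝ) (b : Fin k → ℝ) :
    Matrix (Unit ⊕ Fin k) (Unit ⊕ Fin k) ℝ :=
  Matrix.fromBlocks (scalarBlock σ) (Matrix.replicateRow Unit b)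
    (Matrix.replicateCol Unit b) (D + σ⁻¹ • Matrix.vecMulVec b b)

lemma schurBlock_complement (σ : ℝ) (D : Matrix (Fin k) (Fin k) ℝ) (b : Fin k → ℝ) :
    (D + σ⁻¹ • Matrix.vecMulVec b b) - Matrix.replicateCol Unit b *
      scalarBlock σ⁻¹ * Matrix.replicateRow Unit b = D := by
  ext i j
  simp [Matrix.mul_apply, Matrix.vecMulVec_apply]
  ring

/-- The inverse of a one by one matrix. -/
noncomputable abbrev invertibleScalar {σ : ℝ} (hσ : σ ≠ 0) :
    Invertible (scalarBlock σ) where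
  invOf := scalarBlock σ⁻¹
  invOf_mul_self := by ext i j; simp [hσ]
  mul_invOf_self := by ext i j; simp [hσ]

lemma det_schurBlock {σ : ℝ} (hσ : σ ≠ 0) (D : Matrix (Fin k) (Fin k) ℝ) (b : Fin k → ℝ) :
    (schurBlock σ D b).det = σ * D.det := by
  let := invertibleScalar hσ
  have h := schurBlock_complement σ D b
  rw [schurBlock, Matrix.det_fromBlocks₁₁]
  change _ * (_ - _ * scalarBlock σ⁻¹ * _ : Matrix (Fin k) (Fin k) ℝ).det = _
  rw [h]
  simp

/-- The Schur complement criterion is applied for semidefiniteness and upgraded through `det = σ det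
D`. When `σ ≤ 0` both sides fail, because `σ` is a diagonal entry. -/
lemma posDef_schurBlock {σ : ℝ} (D : Matrix (Fin k) (Fin k) ℝ) (b : Fin k → ℝ) :
    (schurBlock σ D b).PosDef ↔ 0 < σ ∧ D.PosDef := by
  by_cases hσ : 0 < σ
  swap
  · exact ⟨fun h => (hσ (by simpa [schurBlock] using h.diag_pos (i := Sum.inl ()))).elim,
      fun h => (hσ h.1).elim⟩
  have hpd : (scalarBlock σ).PosDef := Matrix.PosDef.diagonal fun _ => hσ
  have hpsd : (schurBlock σ D b).PosSemidef ↔ D.PosSemidef := by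
    let := invertibleScalar hσ.ne'
    have h := hpd.fromBlocks₁₁ (Matrix.replicateRow Unit b) (D + σ⁻¹ • Matrix.vecMulVec b b)
    rw [← Matrix.invOf_eq_nonsing_inv, Matrix.conjTranspose_replicateRow, star_trivial] at h
    change _ ↔ (_ - _ * scalarBlock σ⁻¹ * _ : Matrix (Fin k) (Fin k) ℝ).PosSemidef
      at h
    rwa [schurBlock_complement] at h
  constructor
  · intro h
    refine ⟨hσ, (hpsd.mp h.posSemidef).posDef_iff_det_ne_zero.mpr fun h0 => ?_⟩
    have := h.det_pos
    rw [det_schurBlock hσ.ne', h0, mul_zero] at this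
    exact this.false
  · rintro ⟨-, h⟩
    refine (hpsd.mpr h.posSemidef).posDef_iff_det_ne_zero.mpr ?_
    rw [det_schurBlock hσ.ne']
    exact (mul_pos hσ h.det_pos).ne'

/-- In the block inverse the corner entry is `σ⁻¹ + σ⁻² bᵀD⁻¹b` and the lower block is `D⁻¹`. -/
lemma trace_inv_schurBlock {σ : ℝ} (hσ : 0 < σ) {D : Matrix (Fin k) (Fin k) ℝ} (hD : D.PosDef)
    (b : Fin k → ℝ) :
    (schurBlock σ D b)⁻¹.trace = σ⁻¹ + σ⁻¹ ^ 2 * (b ⬝ᵥ (D⁻¹ *ᵥ b)) + D⁻¹.trace := by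
  let := invertibleScalar hσ.ne'
  have hc : (D + σ⁻¹ • Matrix.vecMulVec b b) - Matrix.replicateCol Unit b *
      ⅟(scalarBlock σ) * Matrix.replicateRow Unit b = D := schurBlock_complement σ D b
  let : Invertible ((D + σ⁻¹ • Matrix.vecMulVec b b) - Matrix.replicateCol Unit b *
      ⅟(scalarBlock σ) * Matrix.replicateRow Unit b) :=
    Matrix.invertibleOfIsUnitDet _ (by rw [hc]; exact isUnit_iff_ne_zero.mpr hD.det_pos.ne')
  let : Invertible (Matrix.fromBlocks (scalarBlock σ) (Matrix.replicateRow Unit b)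
      (Matrix.replicateCol Unit b) (D + σ⁻¹ • Matrix.vecMulVec b b)) :=
    Matrix.invertibleOfIsUnitDet _
      (isUnit_iff_ne_zero.mpr ((posDef_schurBlock D b).mpr ⟨hσ, hD⟩).det_pos.ne')
  have hinv : ⅟((D + σ⁻¹ • Matrix.vecMulVec b b) - Matrix.replicateCol Unit b *
      ⅟(scalarBlock σ) * Matrix.replicateRow Unit b) = D⁻¹ := by
    rw [Matrix.invOf_eq_nonsing_inv, hc]
  rw [schurBlock, ← Matrix.invOf_eq_nonsing_inv, Matrix.invOf_fromBlocks₁₁_eq, hinv,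
    Matrix.trace, Fintype.sum_sum_type]
  congr 1
  change Matrix.trace (scalarBlock σ⁻¹ + scalarBlock σ⁻¹ *
    Matrix.replicateRow Unit b * D⁻¹ * Matrix.replicateCol Unit b *
      scalarBlock σ⁻¹) = _
  simp only [Matrix.trace, Finset.univ_unique, Finset.sum_singleton, Matrix.diag_apply,
    Matrix.add_apply, Matrix.diagonal_apply_eq, Matrix.mul_diagonal]
  rw [Matrix.mul_assoc, Matrix.mul_assoc, Matrix.diagonal_mul, ← Matrix.replicateCol_mulVec]
  simp [Matrix.mul_apply, dotProduct]
  ring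

/-- Separates the first index from the others. -/
def finSuccSum (k : ℕ) : Fin (k + 1) ≃ Unit ⊕ Fin k :=
  (finSuccEquiv k).trans ((Equiv.optionEquivSumPUnit (Fin k)).trans (Equiv.sumComm _ _))

lemma finSuccSum_zero : finSuccSum k 0 = Sum.inl () := rfl

lemma finSuccSum_succ (i : Fin k) : finSuccSum k i.succ = Sum.inr i := by
  simp [finSuccSum]

/-- Coordinates on symmetric matrices of size `k + 1`: the first diagonal entry, the remaining
diagonal block, and the rest of the first column. -/
noncomputable def symBlock : (ℝ × (Sym2 (Fin k) → ℝ) × (Fin k → ℝ)) ≃ₗ[ℝ] (Sym2 (Fin (k + 1)) → ℝ) where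
  toFun p := Sym2.lift ⟨fun i j => Matrix.fromBlocks (scalarBlock p.1)
    (Matrix.replicateRow Unit p.2.2) (Matrix.replicateCol Unit p.2.2) (symMatrix p.2.1)
    (finSuccSum k i) (finSuccSum k j), fun i j => by
      cases hi : finSuccSum k i <;> cases hj : finSuccSum k j <;>
        simp [hi, hj, symMatrix, Sym2.eq_swap]⟩
  map_add' p q := by
    ext z
    induction z with
    | _ i j =>
      cases hi : finSuccSum k i <;> cases hj : finSuccSum k j <;> simp [hi, hj, symMatrix]
  map_smul' c p := by
    ext z
    induction z with
    | _ i j =>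
      cases hi : finSuccSum k i <;> cases hj : finSuccSum k j <;> simp [hi, hj, symMatrix]
  invFun s := (s s(0, 0), fun z => s (z.map Fin.succ), fun i => s s(0, i.succ))
  left_inv p := by
    refine Prod.ext rfl (Prod.ext (funext fun z => ?_) (funext fun i => ?_))
    · induction z with
      | _ i j => simp [finSuccSum_succ, symMatrix]
    · simp [finSuccSum_succ, finSuccSum_zero]
  right_inv s := by
    ext z
    induction z with
    | _ i j =>
      cases i using Fin.cases <;> cases j using Fin.cases <;>
        simp [finSuccSum_succ, finSuccSum_zero, symMatrix, Sym2.eq_swap]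

/-- The symmetric matrix `b bᵀ`. -/
def symOuter (b : Fin k → ℝ) : Sym2 (Fin k) → ℝ :=
  Sym2.lift ⟨fun i j => b i * b j, fun _ _ => mul_comm _ _⟩

/-- For fixed `(σ, b)`, passing from the lower block to the Schur complement `D` is a translation by
`σ⁻¹ b bᵀ`. It therefore preserves Lebesgue measure, although the coordinates `(σ, D, b)` are not
linear. -/
lemma symMatrix_symBlock_add (σ : ℝ) (D : Sym2 (Fin k) → ℝ) (b : Fin k → ℝ) :
    symMatrix (symBlock (σ, σ⁻¹ • symOuter b + D, b)) =
      (schurBlock σ (symMatrix D) b).submatrix (finSuccSum k) (finSuccSum k) := by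
  have h : schurBlock σ (symMatrix D) b = Matrix.fromBlocks (scalarBlock σ)
    (Matrix.replicateRow Unit b) (Matrix.replicateCol Unit b)
    (symMatrix (σ⁻¹ • symOuter b + D)) := by
    rw [add_comm]; rfl
  rw [h]; rfl

lemma symBlock_mem_posDefSet (σ : ℝ) (D : Sym2 (Fin k) → ℝ) (b : Fin k → ℝ) :
    symBlock (σ, σ⁻¹ • symOuter b + D, b) ∈ posDefSet (k + 1) ↔ 0 < σ ∧ D ∈ posDefSet k := by
  rw [posDefSet, Set.mem_ofPred_eq, symMatrix_symBlock_add, posDefSet, Set.mem_ofPred_eq,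
    ← posDef_schurBlock (symMatrix D) b]
  refine ⟨fun h => ?_, fun h => h.submatrix (finSuccSum k).injective⟩
  simpa using h.submatrix (finSuccSum k).symm.injective

/-- The determinant and trace formulas separate the variables. Normalizing the Gaussian factor in
`b`, of covariance `σ² D`, takes `σ^(-k) |D|^(-1/2)` out of `σ^(-m/2) |D|^(-m/2)`; this leaves the
exponent `k - m/2` on `σ` and lowers `m` by one on `D`. -/
lemma invWishartKernel_symBlock (m : ℝ) {σ : ℝ} (hσ : 0 < σ) {D : Sym2 (Fin k) → ℝ}
    (hD : D ∈ posDefSet k) (b : Fin k → ℝ) :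
    invWishartKernel m 1 (symMatrix (symBlock (σ, σ⁻¹ • symOuter b + D, b))) =
      (2 * Real.pi) ^ ((k : ℝ) / 2) *
        (σ ^ (k - m / 2) * Real.exp (-(1 / 2) * σ⁻¹)) *
        invWishartKernel (m - 1) 1 (symMatrix D) * normalDensity 0 (σ ^ 2 • symMatrix D) b := by
  have hDp : (symMatrix D).PosDef := hD
  have hdet := hDp.det_pos
  have h1 : (σ ^ 2 • symMatrix D)⁻¹ = (σ⁻¹ ^ 2) • (symMatrix D)⁻¹ := by
    apply Matrix.inv_eq_right_inv
    rw [Matrix.smul_mul, Matrix.mul_smul, Matrix.mul_nonsing_inv _ hdet.ne'.isUnit, smul_smul,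
      ← mul_pow, mul_inv_cancel₀ hσ.ne', one_pow, one_smul]
  have h2 : (σ ^ 2 • symMatrix D).det ^ (-(1 : ℝ) / 2) =
      σ ^ (-(k : ℝ)) * (symMatrix D).det ^ (-(1 : ℝ) / 2) := by
    rw [Matrix.det_smul, Fintype.card_fin, Real.mul_rpow (by positivity) hdet.le, ← pow_mul,
      ← Real.rpow_natCast, ← Real.rpow_mul hσ.le]
    congr 2
    push_cast
    ring
  have h3 : (2 * Real.pi) ^ ((k : ℝ) / 2) * (2 * Real.pi) ^ (-(k : ℝ) / 2) = 1 := by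
    rw [← Real.rpow_add (by positivity)]
    simp [neg_div]
  have h4 : σ ^ (k - m / 2) * σ ^ (-(k : ℝ)) = σ ^ (-m / 2) := by
    rw [← Real.rpow_add hσ]; congr 1; ring
  have h5 : (symMatrix D).det ^ (-(m - 1) / 2) * (symMatrix D).det ^ (-(1 : ℝ) / 2) =
      (symMatrix D).det ^ (-m / 2) := by
    rw [← Real.rpow_add hdet]; congr 1; ring
  rw [symMatrix_symBlock_add, invWishartKernel, Matrix.mul_one, Matrix.det_submatrix_equiv_self,
    Matrix.inv_submatrix_equiv, det_schurBlock hσ.ne']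
  have h6 : ((schurBlock σ (symMatrix D) b)⁻¹.submatrix (finSuccSum k) (finSuccSum k)).trace =
      (schurBlock σ (symMatrix D) b)⁻¹.trace :=
    Equiv.sum_comp (finSuccSum k) fun i => (schurBlock σ (symMatrix D) b)⁻¹ i i
  rw [h6, trace_inv_schurBlock hσ hDp, normalDensity, h2, invWishartKernel, h1, Matrix.mul_one,
    sub_zero, Real.mul_rpow hσ.le hdet.le, ← h4, ← h5, Matrix.smul_mulVec, dotProduct_smul,
    smul_eq_mul, mul_add, mul_add, Real.exp_add, Real.exp_add]
  -- Only the powers of `2π` remain to be cancelled.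
  linear_combination (- σ ^ (k - m / 2) * Real.exp (-(1 / 2) * σ⁻¹) *
    (symMatrix D).det ^ (-(m - 1) / 2) * Real.exp (-(1 / 2) * ((symMatrix D)⁻¹).trace) *
    σ ^ (-(k : ℝ)) * (symMatrix D).det ^ (-(1 : ℝ) / 2) *
    Real.exp (-(1 / 2) * (σ⁻¹ ^ 2 * (b ⬝ᵥ ((symMatrix D)⁻¹ *ᵥ b))))) * h3

/-! ### The diagonal entries of an inverse Wishart matrix -/

lemma lintegral_normalDensity (μ : Fin k → ℝ) {S : Matrix (Fin k) (Fin k) ℝ} (hS : S.PosDef) :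
    ∫⁻ y, ENNReal.ofReal (normalDensity μ S y) = 1 := by
  have := isProbabilityMeasure_normalLaw μ hS
  have h := measure_univ (μ := normalLaw μ S)
  rwa [normalLaw, withDensity_apply _ MeasurableSet.univ, Measure.restrict_univ] at h

lemma invWishartKernel_pos (m : ℝ) (Ps : Matrix (Fin k) (Fin k) ℝ) {S : Matrix (Fin k) (Fin k) ℝ}
    (hS : S.PosDef) : 0 < invWishartKernel m Ps S := by
  have := hS.det_pos
  unfold invWishartKernel
  positivity

lemma invWishartMeasure_univ (m : ℝ) (Ps : Matrix (Fin k) (Fin k) ℝ) :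
    invWishartMeasure m Ps Set.univ = ∫⁻ s, (posDefSet k).indicator
      (fun s => ENNReal.ofReal (invWishartKernel m Ps (symMatrix s))) s := by
  rw [← lintegral_one, lintegral_invWishartMeasure m Ps measurable_const]
  simp

lemma lintegral_symBlock (m : ℝ) {σ : ℝ} (D : Sym2 (Fin k) → ℝ) :
    ∫⁻ b, (posDefSet (k + 1)).indicator
        (fun s => ENNReal.ofReal (invWishartKernel m 1 (symMatrix s)))
        (symBlock (σ, σ⁻¹ • symOuter b + D, b)) =
      ENNReal.ofReal ((2 * Real.pi) ^ ((k : ℝ) / 2)) *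
        ((Set.Ioi 0).indicator
          (fun σ => ENNReal.ofReal (σ ^ (k - m / 2) * Real.exp (-(1 / 2) * σ⁻¹))) σ *
        (posDefSet k).indicator
          (fun s => ENNReal.ofReal (invWishartKernel (m - 1) 1 (symMatrix s))) D) := by
  by_cases h : 0 < σ ∧ D ∈ posDefSet k
  · obtain ⟨hσ, hD⟩ := h
    have hpd : (σ ^ 2 • symMatrix D).PosDef := Matrix.PosDef.smul hD (by positivity)
    have hk := invWishartKernel_pos (m - 1) 1 hD
    rw [Set.indicator_of_mem (Set.mem_Ioi.mpr hσ), Set.indicator_of_mem hD,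
      ← ENNReal.ofReal_mul (by positivity), ← ENNReal.ofReal_mul (by positivity), ← mul_assoc]
    rw [← mul_one (ENNReal.ofReal _), ← lintegral_normalDensity 0 hpd,
      ← lintegral_const_mul' _ _ ENNReal.ofReal_ne_top]
    refine lintegral_congr fun b => ?_
    rw [Set.indicator_of_mem ((symBlock_mem_posDefSet σ D b).mpr ⟨hσ, hD⟩),
      invWishartKernel_symBlock m hσ hD, ENNReal.ofReal_mul (by positivity)]
  · have h1 : ∀ b, symBlock (σ, σ⁻¹ • symOuter b + D, b) ∉ posDefSet (k + 1) := fun b =>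
      mt (symBlock_mem_posDefSet σ D b).mp h
    simp only [Set.indicator_of_notMem (h1 _), lintegral_zero]
    rcases not_and_or.mp h with h | h
    · rw [Set.indicator_of_notMem (by simpa using h)]; simp
    · rw [Set.indicator_of_notMem h]; simp

/-- The first diagonal entry of an inverse Wishart matrix with identity scale. -/
lemma exists_lintegral_invWishartMeasure_one (k : ℕ) (m : ℝ) :
    ∃ c : ℝ≥0∞, c ≠ 0 ∧ c ≠ ∞ ∧ ∀ F : ℝ → ℝ≥0∞, Measurable F →
      ∫⁻ s, F (s s(0, 0)) ∂(invWishartMeasure (k := k + 1) m 1) =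
        c * ((∫⁻ σ in Set.Ioi 0,
          ENNReal.ofReal (σ ^ (k - m / 2) * Real.exp (-(1 / 2) * σ⁻¹)) * F σ) *
          invWishartMeasure (k := k) (m - 1) 1 Set.univ) := by
  have := Measure.prod.instIsAddHaarMeasure (volume : Measure (Sym2 (Fin k) → ℝ))
    (volume : Measure (Fin k → ℝ))
  have := Measure.prod.instIsAddHaarMeasure (volume : Measure ℝ)
    ((volume : Measure (Sym2 (Fin k) → ℝ)).prod (volume : Measure (Fin k → ℝ)))
  obtain ⟨c, hc0, hct, hc⟩ := exists_lintegral_comp_linearEquiv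
    ((volume : Measure ℝ).prod ((volume : Measure (Sym2 (Fin k) → ℝ)).prod
      (volume : Measure (Fin k → ℝ)))) volume symBlock
  have hpi : 0 < (2 * Real.pi) ^ ((k : ℝ) / 2) := by positivity
  refine ⟨c * ENNReal.ofReal ((2 * Real.pi) ^ ((k : ℝ) / 2)), mul_ne_zero hc0 (by simpa using hpi),
    ENNReal.mul_ne_top hct ENNReal.ofReal_ne_top, fun F hF => ?_⟩
  let q : (Sym2 (Fin (k + 1)) → ℝ) → ℝ≥0∞ := (posDefSet (k + 1)).indicator
    fun s => ENNReal.ofReal (invWishartKernel m 1 (symMatrix s))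
  have hq : Measurable q :=
    (measurable_invWishartKernel m 1).ennreal_ofReal.indicator measurableSet_posDefSet
  have hsym : Measurable (symBlock (k := k)) :=
    (LinearMap.continuous_of_finiteDimensional (symBlock (k := k)).toLinearMap).measurable
  have houter : Measurable (symOuter (k := k)) := by
    refine measurable_pi_lambda _ fun z => ?_
    induction z with
    | _ i j => exact (measurable_pi_apply i).mul (measurable_pi_apply j)
  have hF0 : Measurable fun s : Sym2 (Fin (k + 1)) → ℝ => F (s s(0, 0)) :=
    hF.comp (measurable_pi_apply _)
  have hint : ∀ s, (posDefSet (k + 1)).indicator (fun s =>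
      ENNReal.ofReal (invWishartKernel m 1 (symMatrix s)) * F (s s(0, 0))) s =
        F (s s(0, 0)) * q s := by
    intro s
    by_cases hs : s ∈ posDefSet (k + 1)
    · simp [q, hs, mul_comm]
    · simp [q, hs]
  have hsc : ∀ p : ℝ × (Sym2 (Fin k) → ℝ) × (Fin k → ℝ), symBlock p s(0, 0) = p.1 :=
    fun p => by simp [symBlock, finSuccSum_zero]
  rw [lintegral_invWishartMeasure m 1 hF0, lintegral_congr hint, hc]
  simp only [hsc]
  have hFq : Measurable fun p : ℝ × (Sym2 (Fin k) → ℝ) × (Fin k → ℝ) => F p.1 * q (symBlock p) :=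
    (hF.comp measurable_fst).mul (hq.comp hsym)
  rw [lintegral_prod _ hFq.aemeasurable, mul_assoc]
  congr 1
  rw [← lintegral_indicator measurableSet_Ioi, ← lintegral_mul_const _ (Measurable.indicator
    (by fun_prop) measurableSet_Ioi), ← lintegral_const_mul' _ _ ENNReal.ofReal_ne_top]
  refine lintegral_congr fun σ => ?_
  have hmσ : Measurable fun p : (Sym2 (Fin k) → ℝ) × (Fin k → ℝ) => q (symBlock (σ, p)) :=
    hq.comp (hsym.comp (by fun_prop))
  have hmσ' : Measurable (Function.uncurry fun (b : Fin k → ℝ) (D : Sym2 (Fin k) → ℝ) =>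
      q (symBlock (σ, σ⁻¹ • symOuter b + D, b))) :=
    hq.comp (hsym.comp (by fun_prop))
  dsimp only
  rw [lintegral_const_mul _ hmσ, lintegral_prod_symm _ hmσ.aemeasurable]
  -- Translation invariance in `D` brings in the Schur complement; the order of integration is then
  -- swapped so that `b` is integrated out first.
  have hshift : ∀ b : Fin k → ℝ, ∫⁻ D : Sym2 (Fin k) → ℝ, q (symBlock (σ, D, b)) =
      ∫⁻ D : Sym2 (Fin k) → ℝ, q (symBlock (σ, σ⁻¹ • symOuter b + D, b)) := fun b =>
    (lintegral_add_left_eq_self (fun D => q (symBlock (σ, D, b))) (σ⁻¹ • symOuter b)).symm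
  simp only [hshift]
  rw [lintegral_lintegral_swap hmσ'.aemeasurable, invWishartMeasure_univ]
  simp only [q, lintegral_symBlock]
  rw [lintegral_const_mul' _ _ ENNReal.ofReal_ne_top, lintegral_const_mul _
    ((measurable_invWishartKernel _ 1).ennreal_ofReal.indicator measurableSet_posDefSet)]
  by_cases hσ : 0 < σ
  · rw [Set.indicator_of_mem (Set.mem_Ioi.mpr hσ), Set.indicator_of_mem (Set.mem_Ioi.mpr hσ)]
    ring
  · rw [Set.indicator_of_notMem (by simpa using hσ), Set.indicator_of_notMem (by simpa using hσ)]
    simp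

/-- The inverse gamma distribution as the image of a gamma distribution. -/
lemma lintegral_gammaMeasure_inv {a : ℝ} (ha : 0 < a) {F : ℝ → ℝ≥0∞} (hF : Measurable F) :
    ∫⁻ σ in Set.Ioi 0, ENNReal.ofReal (σ ^ (-a - 1) * Real.exp (-(1 / 2) * σ⁻¹)) * F σ =
      ENNReal.ofReal ((1 / 2) ^ a / Real.Gamma a)⁻¹ *
        ∫⁻ u, F u⁻¹ ∂(gammaMeasure a (1 / 2)) := by
  have hG : 0 < (1 / 2 : ℝ) ^ a / Real.Gamma a := div_pos (by positivity) (Real.Gamma_pos_of_pos ha)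
  have himg : (fun u : ℝ => u⁻¹) '' Set.Ioi 0 = Set.Ioi 0 := by
    ext x
    simp only [Set.mem_image, Set.mem_Ioi]
    exact ⟨by rintro ⟨u, hu, rfl⟩; positivity, fun hx => ⟨x⁻¹, by positivity, inv_inv x⟩⟩
  have hgm : Measurable (gammaPDF a (1 / 2)) := (measurable_gammaPDFReal a _).ennreal_ofReal
  have hFi : Measurable fun u : ℝ => F u⁻¹ := hF.comp measurable_inv
  rw [gammaMeasure, lintegral_withDensity_eq_lintegral_mul _ hgm hFi]
  -- The gamma density need not vanish at `0`, so the restriction to the open half-line holds only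
  -- almost everywhere.
  have h0 : ∀ᵐ u : ℝ, (gammaPDF a (1 / 2) * fun u => F u⁻¹) u = (Set.Ioi 0).indicator
      (fun u => gammaPDF a (1 / 2) u * F u⁻¹) u := by
    filter_upwards [Measure.ae_ne volume (0 : ℝ)] with u hu
    rcases lt_or_gt_of_ne hu with h | h
    · rw [Set.indicator_of_notMem (by simpa using h.le)]
      simp [gammaPDF_of_neg h]
    · rw [Set.indicator_of_mem (Set.mem_Ioi.mpr h)]; rfl
  rw [lintegral_congr_ae h0,
    lintegral_indicator measurableSet_Ioi, ← lintegral_const_mul' _ _ ENNReal.ofReal_ne_top]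
  nth_rewrite 1 [← himg]
  -- The substitution is `σ = u⁻¹`.
  rw [lintegral_image_eq_lintegral_abs_deriv_mul measurableSet_Ioi
    (f' := fun u => -(u ^ 2)⁻¹) (fun x hx => (hasDerivAt_inv (ne_of_gt hx)).hasDerivWithinAt)
    inv_injective.injOn]
  refine setLIntegral_congr_fun measurableSet_Ioi fun u (hu : 0 < u) => ?_
  rw [gammaPDF_of_nonneg hu.le, ← mul_assoc, ← mul_assoc, ← ENNReal.ofReal_mul (abs_nonneg _),
    ← ENNReal.ofReal_mul (inv_nonneg.mpr hG.le)]
  congr 2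
  rw [inv_inv, abs_neg, abs_of_pos (by positivity), Real.inv_rpow hu.le, ← Real.rpow_neg hu.le,
    ← Real.rpow_natCast, ← Real.rpow_neg hu.le, ← mul_assoc, ← mul_assoc, ← mul_assoc,
    ← Real.rpow_add hu, inv_mul_cancel₀ hG.ne', one_mul]
  congr 2
  · push_cast; ring
  · ring

/-- Removing one row lowers both the size and `m` by one, and `m > 2(k + 1)` implies `m - 1 > 2k`.
The factor split off is an inverse gamma integral of shape `m/2 - k - 1 > 0`. In size zero the space
is a point and the kernel is `1`. -/
lemma invWishartMeasure_one_univ (k : ℕ) {m : ℝ} (hm : 2 * (k : ℝ) < m) :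
    invWishartMeasure (k := k) m 1 Set.univ ≠ 0 ∧ invWishartMeasure (k := k) m 1 Set.univ ≠ ∞ := by
  induction k generalizing m with
  | zero =>
    have h : posDefSet 0 = Set.univ := by
      ext s
      simp only [posDefSet, Set.mem_ofPred_eq, Set.mem_univ, iff_true]
      rw [Subsingleton.elim (symMatrix s) 1]
      exact Matrix.PosDef.one
    rw [invWishartMeasure_univ, h]
    simp [invWishartKernel, volume_pi, Matrix.trace]
  | succ k ih =>
    obtain ⟨c, hc0, hct, hc⟩ := exists_lintegral_invWishartMeasure_one k m
    have ha : 0 < m / 2 - k - 1 := by push_cast at hm; linarith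
    have hG : 0 < (1 / 2 : ℝ) ^ (m / 2 - k - 1) / Real.Gamma (m / 2 - k - 1) :=
      div_pos (by positivity) (Real.Gamma_pos_of_pos ha)
    obtain ⟨h1, h2⟩ := ih (m := m - 1) (by push_cast at hm; linarith)
    have h := hc (fun _ => 1) measurable_const
    have h3 := lintegral_gammaMeasure_inv ha (F := fun _ => 1) measurable_const
    have := isProbabilityMeasure_gammaMeasure ha (r := 1 / 2) (by norm_num)
    rw [show -(m / 2 - (k : ℝ) - 1) - 1 = k - m / 2 by ring] at h3
    rw [h3] at h
    simp only [lintegral_one, measure_univ, mul_one] at h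
    rw [h]
    refine ⟨mul_ne_zero hc0 (mul_ne_zero ?_ h1),
      ENNReal.mul_ne_top hct (ENNReal.mul_ne_top ENNReal.ofReal_ne_top h2)⟩
    simpa using inv_pos.mpr hG

lemma invWishartMeasure_univ_ne {m : ℝ} (hm : 2 * (k : ℝ) < m) {S : Matrix (Fin k) (Fin k) ℝ}
    (hS : S.PosDef) :
    invWishartMeasure m S Set.univ ≠ 0 ∧ invWishartMeasure m S Set.univ ≠ ∞ := by
  obtain ⟨A, hA⟩ := exists_mul_transpose_eq hS
  obtain ⟨c, hc0, hct, hc⟩ := exists_lintegral_invWishartMeasure_symConj m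
    (det_ne_zero_of_mul_transpose hS hA)
  obtain ⟨h0, ht⟩ := invWishartMeasure_one_univ k hm
  have h := hc (fun _ => 1) measurable_const
  rw [hA] at h
  simp only [lintegral_one] at h
  rw [h]
  exact ⟨mul_ne_zero hc0 h0, ENNReal.mul_ne_top hct ht⟩

/-- For `Σ` with an inverse Wishart distribution, `vᵀ Ψ v / vᵀ Σ v` has a gamma distribution. -/
lemma lintegral_quadForm_invWishartMeasure {m : ℝ} (hm : 2 * (k : ℝ) < m)
    {S : Matrix (Fin k) (Fin k) ℝ} (hS : S.PosDef) (v : Fin k → ℝ) {F : ℝ → ℝ≥0∞}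
    (hF : Measurable F) :
    ∫⁻ s, F (v ⬝ᵥ (symMatrix s *ᵥ v)) ∂(invWishartMeasure m S) =
      invWishartMeasure m S Set.univ *
        ∫⁻ u, F (v ⬝ᵥ (S *ᵥ v) / u) ∂(gammaMeasure ((m - 2 * k) / 2) (1 / 2)) := by
  have hδ : 0 < (m - 2 * (k : ℝ)) / 2 := by linarith
  have hprob := isProbabilityMeasure_gammaMeasure hδ (r := 1 / 2) (by norm_num)
  cases k with
  | zero =>
    rw [Subsingleton.elim v 0]
    simp only [zero_dotProduct, zero_div, lintegral_const, measure_univ, mul_one]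
    exact mul_comm _ _
  | succ k =>
    obtain ⟨A, hA, hv⟩ := exists_mul_transpose_eq_vecMul hS v
    set Q := v ⬝ᵥ (S *ᵥ v) with hQ
    have hQ0 : 0 ≤ Q := by simpa using hS.posSemidef.dotProduct_mulVec_nonneg v
    obtain ⟨c, -, -, hc⟩ := exists_lintegral_invWishartMeasure_symConj m
      (det_ne_zero_of_mul_transpose hS hA)
    obtain ⟨c', -, -, hc'⟩ := exists_lintegral_invWishartMeasure_one k m
    have hquad : ∀ s, v ⬝ᵥ (symMatrix (symConj A s) *ᵥ v) = Q * s s(0, 0) := by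
      intro s
      rw [symMatrix_symConj, Matrix.mul_assoc, ← Matrix.mulVec_mulVec, Matrix.dotProduct_mulVec,
        hv, ← Matrix.mulVec_mulVec, Matrix.mulVec_transpose, hv, single_dotProduct]
      simp only [Matrix.mulVec_single, Pi.smul_apply, symMatrix, Matrix.col_apply, Matrix.of_apply,
        MulOpposite.smul_eq_mul_unop, MulOpposite.unop_op]
      rw [mul_comm (s _), ← mul_assoc, Real.mul_self_sqrt hQ0]
    -- The prefactors do not depend on `G`; taking `G = 1` identifies their product as the total
    -- mass, without evaluating any of them.
    have key : ∀ G : ℝ → ℝ≥0∞, Measurable G →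
        ∫⁻ s, G (v ⬝ᵥ (symMatrix s *ᵥ v)) ∂(invWishartMeasure m S) =
          c * (c' * ((ENNReal.ofReal ((1 / 2) ^ (m / 2 - k - 1) / Real.Gamma (m / 2 - k - 1))⁻¹ *
            ∫⁻ u, G (Q / u) ∂(gammaMeasure (m / 2 - k - 1) (1 / 2))) *
              invWishartMeasure (k := k) (m - 1) 1 Set.univ)) := by
      intro G hG
      have ha : 0 < m / 2 - k - 1 := by push_cast at hm; linarith
      have hGv : Measurable fun s => G (v ⬝ᵥ (symMatrix s *ᵥ v)) := hG.comp (measurable_quadForm v)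
      have hGQ : Measurable fun σ => G (Q * σ) := hG.comp (measurable_const_mul Q)
      have h1 := hc _ hGv
      simp only [hquad] at h1
      have h2 := lintegral_gammaMeasure_inv ha hGQ
      rw [show -(m / 2 - (k : ℝ) - 1) - 1 = k - m / 2 by ring] at h2
      rw [← hA, h1, hc' _ hGQ, h2]
      simp only [div_eq_mul_inv]
    have ha' : (m - 2 * ((k + 1 : ℕ) : ℝ)) / 2 = m / 2 - k - 1 := by push_cast; ring
    have h1 := key (fun _ => 1) measurable_const
    rw [ha'] at hprob ⊢
    simp only [lintegral_one, measure_univ, mul_one] at h1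
    rw [key F hF, h1]
    ring

/-! ### Student distributions -/

lemma lintegral_comp_mul_left {f : ℝ → ℝ≥0∞} (hf : Measurable f) {a : ℝ} (ha : 0 < a) :
    ∫⁻ x, f x = ENNReal.ofReal a * ∫⁻ x, f (a * x) := by
  nth_rewrite 1 [← Real.smul_map_volume_mul_left ha.ne']
  rw [lintegral_smul_measure, lintegral_map hf (measurable_const_mul a), abs_of_pos ha, smul_eq_mul]

lemma lintegral_gammaMeasure (a r : ℝ) {F : ℝ → ℝ≥0∞} (hF : Measurable F) :
    ∫⁻ u, F u ∂(gammaMeasure a r) =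
      ∫⁻ u in Set.Ioi 0,
        ENNReal.ofReal (r ^ a / Real.Gamma a * u ^ (a - 1) * Real.exp (-(r * u))) * F u := by
  have hgm : Measurable (gammaPDF a r) := (measurable_gammaPDFReal a r).ennreal_ofReal
  rw [gammaMeasure, lintegral_withDensity_eq_lintegral_mul _ hgm hF,
    ← lintegral_indicator measurableSet_Ioi]
  refine lintegral_congr_ae ?_
  filter_upwards [Measure.ae_ne volume (0 : ℝ)] with u hu
  rcases lt_or_gt_of_ne hu with h | h
  · rw [Set.indicator_of_notMem (by simpa using h.le)]
    simp [gammaPDF_of_neg h]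
  · rw [Set.indicator_of_mem (Set.mem_Ioi.mpr h), Pi.mul_apply, gammaPDF_of_nonneg h.le]

lemma lintegral_gammaMeasure_div (a r : ℝ) {c : ℝ} (hc : 0 < c) (hr : 0 < r) {F : ℝ → ℝ≥0∞}
    (hF : Measurable F) :
    ∫⁻ u, F (u / c) ∂(gammaMeasure a r) = ∫⁻ u, F u ∂(gammaMeasure a (r * c)) := by
  have hFc : Measurable fun u => F (u / c) := hF.comp (measurable_id.div_const c)
  have hm : Measurable ((Set.Ioi 0).indicator fun u => ENNReal.ofReal
      (r ^ a / Real.Gamma a * u ^ (a - 1) * Real.exp (-(r * u))) * F (u / c)) :=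
    Measurable.indicator (by fun_prop) measurableSet_Ioi
  rw [lintegral_gammaMeasure _ _ hFc, lintegral_gammaMeasure _ _ hF,
    ← lintegral_indicator measurableSet_Ioi, ← lintegral_indicator measurableSet_Ioi,
    lintegral_comp_mul_left hm hc, ← lintegral_const_mul' _ _ ENNReal.ofReal_ne_top]
  refine lintegral_congr fun u => ?_
  by_cases hu : 0 < u
  · rw [Set.indicator_of_mem (Set.mem_Ioi.mpr (by positivity)),
      Set.indicator_of_mem (Set.mem_Ioi.mpr hu), ← mul_assoc, ← ENNReal.ofReal_mul hc.le,
      mul_div_cancel_left₀ _ hc.ne', Real.mul_rpow hc.le hu.le, Real.mul_rpow hr.le hc.le,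
      Real.rpow_sub_one hc.ne', mul_assoc r c u]
    congr 2
    field_simp
  · have : ¬ 0 < c * u := fun h => hu ((mul_pos_iff_of_pos_left hc).mp h)
    rw [Set.indicator_of_notMem (by simpa using this), Set.indicator_of_notMem (by simpa using hu),
      mul_zero]

/-- The joint density of `(Z / √V, V)` for a standard normal `Z` and an independent gamma
variable `V`. -/
lemma lintegral_gammaMeasure_gaussianReal {a : ℝ} (ha : 0 < a) {g : ℝ × ℝ → ℝ≥0∞}
    (hg : Measurable g) :
    ∫⁻ u, ∫⁻ y, g (y / √u, u) ∂(gaussianReal 0 1) ∂(gammaMeasure a (1 / 2)) =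
      ∫⁻ t, ∫⁻ u in Set.Ioi 0, ENNReal.ofReal ((1 / 2) ^ a / Real.Gamma a / √(2 * Real.pi) *
        u ^ (a - 1 / 2) * Real.exp (-((1 + t ^ 2) / 2 * u))) * g (t, u) := by
  have hG : 0 < (1 / 2 : ℝ) ^ a / Real.Gamma a := div_pos (by positivity) (Real.Gamma_pos_of_pos ha)
  have hm1 : Measurable fun u => ∫⁻ y, g (y / √u, u) ∂(gaussianReal 0 1) :=
    Measurable.lintegral_prod_right' (f := fun p : ℝ × ℝ => g (p.2 / √p.1, p.1)) (by fun_prop)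
  have hm2 : Measurable (Function.uncurry fun t u : ℝ =>
      ENNReal.ofReal ((1 / 2) ^ a / Real.Gamma a / √(2 * Real.pi) *
        u ^ (a - 1 / 2) * Real.exp (-((1 + t ^ 2) / 2 * u))) * g (t, u)) := by
    unfold Function.uncurry
    fun_prop
  rw [lintegral_gammaMeasure _ _ hm1, lintegral_lintegral_swap hm2.aemeasurable]
  refine setLIntegral_congr_fun measurableSet_Ioi fun u (hu : 0 < u) => ?_
  have hgu : Measurable fun y => g (y / √u, u) := by fun_prop
  have hgu' : Measurable fun y => gaussianPDF 0 1 y * g (y / √u, u) :=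
    (measurable_gaussianPDF 0 1).mul hgu
  rw [gaussianReal_of_var_ne_zero 0 one_ne_zero,
    lintegral_withDensity_eq_lintegral_mul _ (measurable_gaussianPDF 0 1) hgu]
  simp only [Pi.mul_apply]
  -- The substitution `y = √u t` contributes the extra half power of `u`.
  rw [lintegral_comp_mul_left hgu' (Real.sqrt_pos.mpr hu), ← mul_assoc,
    ← lintegral_const_mul' _ _ (ENNReal.mul_ne_top ENNReal.ofReal_ne_top ENNReal.ofReal_ne_top)]
  refine lintegral_congr fun t => ?_
  rw [mul_div_cancel_left₀ _ (Real.sqrt_pos.mpr hu).ne', gaussianPDF, ← mul_assoc,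
    ← ENNReal.ofReal_mul (by positivity), ← ENNReal.ofReal_mul (by positivity)]
  congr 2
  rw [gaussianPDFReal, show a - 1 / 2 = (a - 1) + 1 / 2 by ring, Real.rpow_add hu,
    ← Real.sqrt_eq_rpow, NNReal.coe_one, mul_one, mul_one, sub_zero, mul_pow, Real.sq_sqrt hu.le,
    show -((1 + t ^ 2) / 2 * u) = -(1 / 2 * u) + -(u * t ^ 2) / 2 by ring, Real.exp_add]
  field_simp

/-- Dividing by `√d` cancels the scaling in the definition and leaves `Z / √V`. -/
lemma lintegral_studentT {d : ℝ} (hd : 0 < d) {F : ℝ → ℝ≥0∞} (hF : Measurable F) :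
    ∫⁻ t, F (t / √d) ∂(studentT d) =
      ∫⁻ u, ∫⁻ z, F (z / √u) ∂(gaussianReal 0 1) ∂(gammaMeasure (d / 2) (1 / 2)) := by
  have := isProbabilityMeasure_gammaMeasure (half_pos hd) (r := 1 / 2) (by norm_num)
  have hFd : Measurable fun t => F (t / √d) := by fun_prop
  have hm : Measurable fun p : ℝ × ℝ => F (p.1 / √(p.2 / d) / √d) := by fun_prop
  rw [studentT, lintegral_map hFd (by fun_prop), lintegral_prod_symm _ hm.aemeasurable]
  refine lintegral_congr fun u => lintegral_congr fun z => ?_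
  rw [div_div, Real.sqrt_div' _ hd.le, div_mul_cancel₀ _ (Real.sqrt_pos.mpr hd).ne']

/-- A pair of normal variables with common random precision, in terms of two independent
Student variables. -/
lemma lintegral_gammaMeasure_gaussianReal_eq_studentT {d : ℝ} (hd : 0 < d) {F : ℝ × ℝ → ℝ≥0∞}
    (hF : Measurable F) :
    ∫⁻ u, ∫⁻ y, ∫⁻ z, F (y / √u, z / √u) ∂(gaussianReal 0 1) ∂(gaussianReal 0 1)
        ∂(gammaMeasure (d / 2) (1 / 2)) =
      ∫⁻ t₁, ∫⁻ t₂, F (t₁ / √d, √(1 + t₁ ^ 2 / d) * (t₂ / √(d + 1))) ∂(studentT (d + 1))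
        ∂(studentT d) := by
  have hd1 : 0 < d + 1 := by linarith
  have hγ := isProbabilityMeasure_gammaMeasure (half_pos hd1) (r := 1 / 2) (by norm_num)
  -- `G (t, u)` averages over `z` given `y/√u = t` and `u`; `H t` below averages `G` over the
  -- conditional law of `u` given `t`.
  let G : ℝ × ℝ → ℝ≥0∞ := fun p => ∫⁻ z, F (p.1, z / √p.2) ∂(gaussianReal 0 1)
  have hG : Measurable G := Measurable.lintegral_prod_right'
    (f := fun q : (ℝ × ℝ) × ℝ => F (q.1.1, q.2 / √q.1.2)) (by fun_prop)
  let H : ℝ → ℝ≥0∞ := fun t => ∫⁻ u, G (t, u / (1 + t ^ 2)) ∂(gammaMeasure ((d + 1) / 2) (1 / 2))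
  have hH : Measurable H := Measurable.lintegral_prod_right'
    (f := fun q : ℝ × ℝ => G (q.1, q.2 / (1 + q.1 ^ 2))) (by fun_prop)
  have hpos : ∀ t : ℝ, 0 < 1 + t ^ 2 := fun t => by positivity
  have hR : ∀ t₁ : ℝ, ∫⁻ t₂, F (t₁ / √d, √(1 + t₁ ^ 2 / d) * (t₂ / √(d + 1)))
      ∂(studentT (d + 1)) = H (t₁ / √d) := by
    intro t₁
    rw [lintegral_studentT hd1 (F := fun x => F (t₁ / √d, √(1 + t₁ ^ 2 / d) * x)) (by fun_prop)]
    refine lintegral_congr fun u => lintegral_congr fun z => ?_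
    rw [div_pow, Real.sq_sqrt hd.le, Real.sqrt_div' _ (by positivity)]
    congr 2
    rw [div_div_eq_mul_div]
    ring
  simp only [hR]
  rw [lintegral_studentT hd hH, lintegral_gammaMeasure_gaussianReal (half_pos hd) (g := G) hG,
    lintegral_gammaMeasure_gaussianReal (half_pos hd) (g := fun p => H p.1) (by fun_prop)]
  refine lintegral_congr fun t => ?_
  have hb : d / 2 - 1 / 2 = (d + 1) / 2 - 1 := by ring
  have hr : 1 / 2 * (1 + t ^ 2) = (1 + t ^ 2) / 2 := by ring
  have hGt : Measurable fun u => G (t, u) := by fun_prop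
  have hrp : 0 < (1 + t ^ 2) / 2 := by positivity
  set κ : ℝ := (1 / 2) ^ (d / 2) / Real.Gamma (d / 2) / √(2 * Real.pi) with hκ
  have hκ0 : 0 < κ := div_pos (div_pos (by positivity) (Real.Gamma_pos_of_pos (half_pos hd)))
    (by positivity)
  set ρ : ℝ := ((1 + t ^ 2) / 2) ^ ((d + 1) / 2) / Real.Gamma ((d + 1) / 2) with hρ
  have hρ0 : 0 < ρ := div_pos (by positivity) (Real.Gamma_pos_of_pos (half_pos hd1))
  -- For fixed `t`, the joint density in `u` is a multiple of the gamma density of shape `(d+1)/2`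
  -- and rate `(1+t²)/2`. Used for `G (t, ·)` and for the constant `H t`, it gives the same factor
  -- `κ / ρ` on both sides.
  have hdens : ∀ G' : ℝ → ℝ≥0∞, Measurable G' →
      ∫⁻ u in Set.Ioi 0, ENNReal.ofReal (κ * u ^ (d / 2 - 1 / 2) *
        Real.exp (-((1 + t ^ 2) / 2 * u))) * G' u =
      ENNReal.ofReal (κ / ρ) * ∫⁻ u, G' u ∂(gammaMeasure ((d + 1) / 2) ((1 + t ^ 2) / 2)) := by
    intro G' hG'
    rw [lintegral_gammaMeasure _ _ hG', ← lintegral_const_mul' _ _ ENNReal.ofReal_ne_top]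
    refine lintegral_congr fun u => ?_
    rw [← mul_assoc, ← ENNReal.ofReal_mul (by positivity), hb, ← hρ]
    congr 2
    field_simp
  have hprob := isProbabilityMeasure_gammaMeasure (half_pos hd1) hrp
  rw [hdens _ hGt, hdens (fun _ => H t) measurable_const, lintegral_const, measure_univ, mul_one]
  congr 1
  rw [← hr, ← lintegral_gammaMeasure_div _ _ (hpos t) (by norm_num) hGt]

variable {n : ℕ}

/-! ### Posteriors of normal-inverse-Wishart form -/

lemma measurable_symMatrix_normalDensity (c : Fin k → ℝ) (r : ℝ) :
    Measurable fun θ : Param k => normalDensity c (r⁻¹ • symMatrix θ.2) θ.1 :=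
  measurable_normalDensity.comp (g := fun p : Param k × (Fin k → ℝ) =>
      normalDensity p.1.1 (symMatrix p.1.2) p.2)
    (f := fun θ : Param k => ((c, r⁻¹ • θ.2), θ.1)) (by fun_prop)

lemma lintegral_invWishartMeasure_congr (m : ℝ) (S : Matrix (Fin k) (Fin k) ℝ)
    {F G : (Sym2 (Fin k) → ℝ) → ℝ≥0∞} (h : ∀ s ∈ posDefSet k, F s = G s) :
    ∫⁻ s, F s ∂(invWishartMeasure m S) = ∫⁻ s, G s ∂(invWishartMeasure m S) := by
  refine lintegral_congr_ae ?_
  refine (withDensity_absolutelyContinuous _ _).ae_le ?_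
  filter_upwards [ae_restrict_mem measurableSet_posDefSet] with s hs using h s hs

/-- If the product of likelihood and prior is a multiple of a normal-inverse-Wishart density, then
so is the posterior. -/
lemma lintegral_unnormalizedPosterior {x : Fin n → Fin k → ℝ}
    {prior : (Fin k → ℝ) → Matrix (Fin k) (Fin k) ℝ → ℝ} {C m r : ℝ} {c : Fin k → ℝ}
    {S : Matrix (Fin k) (Fin k) ℝ} (hC : 0 < C)
    (h : ∀ μ Sg, Sg.PosDef → likelihood x μ Sg * prior μ Sg =
      C * (invWishartKernel m S Sg * normalDensity c (r⁻¹ • Sg) μ))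
    {H : Param k → ℝ≥0∞} (hH : Measurable H) :
    ∫⁻ θ, H θ ∂(unnormalizedPosterior x prior) =
      ENNReal.ofReal C * ∫⁻ s, ∫⁻ μ, H (μ, s) ∂(normalLaw c (r⁻¹ • symMatrix s))
        ∂(invWishartMeasure m S) := by
  have hset : {θ : Param k | (symMatrix θ.2).PosDef} = Set.univ ×ˢ posDefSet k := by
    ext θ; simp [posDefSet]
  have hmset : MeasurableSet (Set.univ ×ˢ posDefSet k : Set (Param k)) :=
    MeasurableSet.univ.prod measurableSet_posDefSet
  have hk : Measurable fun θ : Param k => invWishartKernel m S (symMatrix θ.2) :=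
    (measurable_invWishartKernel m S).comp measurable_snd
  have hnd := measurable_symMatrix_normalDensity c r
  have hmeas : Measurable fun θ : Param k => ENNReal.ofReal
      (C * (invWishartKernel m S (symMatrix θ.2) * normalDensity c (r⁻¹ • symMatrix θ.2) θ.1)) := by
    fun_prop
  have hU : unnormalizedPosterior x prior =
      (volume.restrict (Set.univ ×ˢ posDefSet k)).withDensity fun θ => ENNReal.ofReal
      (C * (invWishartKernel m S (symMatrix θ.2) *
        normalDensity c (r⁻¹ • symMatrix θ.2) θ.1)) := by
    rw [unnormalizedPosterior, hset]
    refine withDensity_congr_ae ?_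
    filter_upwards [ae_restrict_mem hmset] with θ hθ
    rw [h _ _ hθ.2]
  have hN : Measurable fun p : (Sym2 (Fin k) → ℝ) × (Fin k → ℝ) =>
      ENNReal.ofReal (normalDensity c (r⁻¹ • symMatrix p.1) p.2) :=
    (hnd.comp measurable_swap).ennreal_ofReal
  have hI : Measurable fun s : Sym2 (Fin k) → ℝ =>
      ∫⁻ μ, ENNReal.ofReal (normalDensity c (r⁻¹ • symMatrix s) μ) * H (μ, s) :=
    Measurable.lintegral_prod_right' (f := fun p : (Sym2 (Fin k) → ℝ) × (Fin k → ℝ) =>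
      ENNReal.ofReal (normalDensity c (r⁻¹ • symMatrix p.1) p.2) * H (p.2, p.1)) (by fun_prop)
  have hlaw : ∀ s : Sym2 (Fin k) → ℝ, ∫⁻ μ, H (μ, s) ∂(normalLaw c (r⁻¹ • symMatrix s)) =
      ∫⁻ μ, ENNReal.ofReal (normalDensity c (r⁻¹ • symMatrix s) μ) * H (μ, s) := by
    intro s
    have h1 : Measurable fun μ => ENNReal.ofReal (normalDensity c (r⁻¹ • symMatrix s) μ) :=
      (measurable_normalDensity_right c _).ennreal_ofReal
    have h2 : Measurable fun μ => H (μ, s) := by fun_prop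
    rw [normalLaw, lintegral_withDensity_eq_lintegral_mul _ h1 h2]
    rfl
  rw [hU, lintegral_withDensity_eq_lintegral_mul _ hmeas hH, ← lintegral_indicator hmset,
    Measure.volume_eq_prod, lintegral_prod_symm _ ((hmeas.mul hH).indicator hmset).aemeasurable]
  simp only [hlaw]
  rw [lintegral_invWishartMeasure m S hI, ← lintegral_const_mul' _ _ ENNReal.ofReal_ne_top]
  refine lintegral_congr fun s => ?_
  by_cases hs : s ∈ posDefSet k
  · have hkpos := invWishartKernel_pos m S (show (symMatrix s).PosDef from hs)
    rw [Set.indicator_of_mem hs, ← mul_assoc, ← ENNReal.ofReal_mul hC.le,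
      ← lintegral_const_mul' _ _ ENNReal.ofReal_ne_top]
    refine lintegral_congr fun μ => ?_
    rw [Set.indicator_of_mem (Set.mk_mem_prod (Set.mem_univ μ) hs), Pi.mul_apply, ← mul_assoc,
      ENNReal.ofReal_mul (mul_pos hC hkpos).le, mul_assoc]
  · rw [Set.indicator_of_notMem hs, mul_zero]
    have : ∀ μ : Fin k → ℝ, (μ, s) ∉ (Set.univ ×ˢ posDefSet k : Set (Param k)) :=
      fun μ h => hs h.2
    simp only [Set.indicator_of_notMem (this _), lintegral_zero]

/-- The conditional law of the wealth depends only on the conditional mean and variance of the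
portfolio return. -/
lemma lintegral_wealthLaw (W rf : ℝ) (v : Fin k → ℝ) {θ : Param k} (hθ : (symMatrix θ.2).PosDef)
    {F : ℝ → ℝ≥0∞} (hF : Measurable F) :
    ∫⁻ w, F w ∂(wealthLaw W rf v θ) =
      ∫⁻ z, F (W * (1 + rf + (v ⬝ᵥ θ.1 + √(v ⬝ᵥ (symMatrix θ.2 *ᵥ v)) * z -
        v ⬝ᵥ fun _ => rf))) ∂(gaussianReal 0 1) := by
  have hw : Measurable (wealth W rf v) := by
    unfold wealth dotProduct
    fun_prop
  rw [wealthLaw, lintegral_map hF hw]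
  simp only [wealth, dotProduct_sub]
  exact lintegral_dotProduct_normalLaw v θ.1 hθ
    (F := fun X => F (W * (1 + rf + (X - v ⬝ᵥ fun _ => rf)))) (by fun_prop)

lemma posDef_inv_smul {r : ℝ} (hr : 0 < r) {S : Matrix (Fin k) (Fin k) ℝ} (hS : S.PosDef) :
    (r⁻¹ • S).PosDef := hS.smul (inv_pos.mpr hr)

section

variable {x : Fin n → Fin k → ℝ} {prior : (Fin k → ℝ) → Matrix (Fin k) (Fin k) ℝ → ℝ}
  {C m r : ℝ} {c : Fin k → ℝ} {S : Matrix (Fin k) (Fin k) ℝ}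

lemma unnormalizedPosterior_univ (hC : 0 < C) (hr : 0 < r)
    (h : ∀ μ Sg, Sg.PosDef → likelihood x μ Sg * prior μ Sg =
      C * (invWishartKernel m S Sg * normalDensity c (r⁻¹ • Sg) μ)) :
    unnormalizedPosterior x prior Set.univ =
      ENNReal.ofReal C * invWishartMeasure m S Set.univ := by
  rw [← lintegral_one, lintegral_unnormalizedPosterior hC h measurable_const, ← lintegral_one]
  congr 1
  refine lintegral_invWishartMeasure_congr m S fun s hs => ?_
  have := isProbabilityMeasure_normalLaw c (posDef_inv_smul hr (show (symMatrix s).PosDef from hs))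
  simp

lemma isProbabilityMeasure_posterior (hm : 2 * (k : ℝ) < m) (hS : S.PosDef) (hC : 0 < C)
    (hr : 0 < r)
    (h : ∀ μ Sg, Sg.PosDef → likelihood x μ Sg * prior μ Sg =
      C * (invWishartKernel m S Sg * normalDensity c (r⁻¹ • Sg) μ)) :
    IsProbabilityMeasure (posterior x prior) := by
  obtain ⟨h0, ht⟩ := invWishartMeasure_univ_ne hm hS
  constructor
  rw [posterior, Measure.smul_apply, smul_eq_mul, unnormalizedPosterior_univ hC hr h]
  exact ENNReal.inv_mul_cancel (mul_ne_zero (by simpa using hC) h0)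
    (ENNReal.mul_ne_top ENNReal.ofReal_ne_top ht)

/-- Both Gaussian sources of uncertainty, the mean and the new return, have variance proportional to
the same `q = vᵀΣv`. Replacing `q` by `vᵀSv / u` leaves two normals with a common random precision
`u`. -/
lemma lintegral_predictiveWealth (hm : 2 * (k : ℝ) < m) (hS : S.PosDef) (hC : 0 < C)
    (hr : 0 < r)
    (h : ∀ μ Sg, Sg.PosDef → likelihood x μ Sg * prior μ Sg =
      C * (invWishartKernel m S Sg * normalDensity c (r⁻¹ • Sg) μ))
    (W rf : ℝ) (v : Fin k → ℝ) {F : ℝ → ℝ≥0∞} (hF : Measurable F) :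
    ∫⁻ w, F w ∂(predictiveWealth x prior W rf v) =
      ∫⁻ t₁, ∫⁻ t₂, F (W * (1 + rf + v ⬝ᵥ (c - fun _ => rf) + √(v ⬝ᵥ (S *ᵥ v)) *
          (t₁ / √(r * (m - 2 * k)) + √(1 + t₁ ^ 2 / (m - 2 * k)) * (t₂ / √(m - 2 * k + 1)))))
        ∂(studentT (m - 2 * k + 1)) ∂(studentT (m - 2 * k)) := by
  obtain ⟨h0, ht⟩ := invWishartMeasure_univ_ne hm hS
  have hd : 0 < m - 2 * (k : ℝ) := by linarith
  set Q := v ⬝ᵥ (S *ᵥ v) with hQ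
  have hQ0 : 0 ≤ Q := by simpa using hS.posSemidef.dotProduct_mulVec_nonneg v
  -- Here `y` is the standardized error in the mean, of variance `q / r`, and `z` the standardized
  -- noise in the new return, of variance `q`.
  let K : ℝ → ℝ → ℝ → ℝ≥0∞ := fun q y z =>
    F (W * (1 + rf + (v ⬝ᵥ c + √(q / r) * y + √q * z - v ⬝ᵥ fun _ => rf)))
  let L : ℝ → ℝ≥0∞ := fun q => ∫⁻ y, ∫⁻ z, K q y z ∂(gaussianReal 0 1) ∂(gaussianReal 0 1)
  have hL : Measurable L :=
    Measurable.lintegral_prod_right' (f := fun p : ℝ × ℝ => ∫⁻ z, K p.1 p.2 z ∂(gaussianReal 0 1))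
      (Measurable.lintegral_prod_right' (f := fun p : (ℝ × ℝ) × ℝ => K p.1.1 p.1.2 p.2)
        (by fun_prop))
  have hwm : Measurable fun θ => ∫⁻ w, F w ∂(wealthLaw W rf v θ) :=
    (Measure.measurable_lintegral hF).comp (measurable_wealthLaw W rf v)
  have hinner : ∀ s ∈ posDefSet k, ∫⁻ μ, ∫⁻ w, F w ∂(wealthLaw W rf v (μ, s))
      ∂(normalLaw c (r⁻¹ • symMatrix s)) = L (v ⬝ᵥ (symMatrix s *ᵥ v)) := by
    intro s hs
    have hs' : (symMatrix s).PosDef := hs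
    let M : ℝ → ℝ≥0∞ := fun a => ∫⁻ z, F (W * (1 + rf + (a + √(v ⬝ᵥ (symMatrix s *ᵥ v)) * z -
        v ⬝ᵥ fun _ => rf))) ∂(gaussianReal 0 1)
    have hM : Measurable M := Measurable.lintegral_prod_right' (f := fun p : ℝ × ℝ =>
      F (W * (1 + rf + (p.1 + √(v ⬝ᵥ (symMatrix s *ᵥ v)) * p.2 - v ⬝ᵥ fun _ => rf))))
      (by fun_prop)
    have h1 : ∀ μ, ∫⁻ w, F w ∂(wealthLaw W rf v (μ, s)) = M (v ⬝ᵥ μ) := fun μ =>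
      lintegral_wealthLaw W rf v (θ := (μ, s)) hs' hF
    simp only [h1]
    rw [lintegral_dotProduct_normalLaw v c (posDef_inv_smul hr hs') hM]
    simp only [M, L, K, Matrix.smul_mulVec, dotProduct_smul, smul_eq_mul, div_eq_inv_mul]
  rw [predictiveWealth, Measure.lintegral_bind (measurable_wealthLaw W rf v).aemeasurable
    hF.aemeasurable, posterior, lintegral_smul_measure, unnormalizedPosterior_univ hC hr h,
    lintegral_unnormalizedPosterior hC h hwm, lintegral_invWishartMeasure_congr m S hinner,
    lintegral_quadForm_invWishartMeasure hm hS v hL, smul_eq_mul, ← mul_assoc, ← mul_assoc,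
    mul_assoc _ (ENNReal.ofReal C), ENNReal.inv_mul_cancel (mul_ne_zero (by simpa using hC) h0)
    (ENNReal.mul_ne_top ENNReal.ofReal_ne_top ht), one_mul]
  let Φ : ℝ × ℝ → ℝ≥0∞ := fun p =>
    F (W * (1 + rf + v ⬝ᵥ (c - fun _ => rf) + √Q * (p.1 / √r + p.2)))
  have hΦ : Measurable Φ := by fun_prop
  have h2 := lintegral_gammaMeasure_gaussianReal_eq_studentT hd hΦ
  calc _ = _ := ?_
    _ = _ := h2
    _ = _ := ?_
  · refine lintegral_congr fun u => lintegral_congr fun y => lintegral_congr fun z => ?_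
    simp only [K, Φ, dotProduct_sub]
    rw [Real.sqrt_div' _ hr.le, Real.sqrt_div hQ0]
    congr 1
    ring
  · refine lintegral_congr fun t₁ => lintegral_congr fun t₂ => ?_
    simp only [Φ]
    rw [div_div, ← Real.sqrt_mul hd.le, mul_comm r]

/-- The posterior predictive wealth as a function of two independent Student variables. -/
lemma hasLaw_predictiveWealth (hm : 2 * (k : ℝ) < m) (hS : S.PosDef) (hC : 0 < C)
    (hr : 0 < r)
    (h : ∀ μ Sg, Sg.PosDef → likelihood x μ Sg * prior μ Sg =
      C * (invWishartKernel m S Sg * normalDensity c (r⁻¹ • Sg) μ))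
    (W rf : ℝ) (v : Fin k → ℝ) {Ω : Type*} [MeasurableSpace Ω] (P : Measure Ω)
    [IsProbabilityMeasure P] (t₁ t₂ : Ω → ℝ) (h₁ : HasLaw t₁ (studentT (m - 2 * k)) P)
    (h₂ : HasLaw t₂ (studentT (m - 2 * k + 1)) P) (hind : IndepFun t₁ t₂ P) :
    HasLaw (fun ω => W * (1 + rf + v ⬝ᵥ (c - fun _ => rf) + √(v ⬝ᵥ (S *ᵥ v)) *
          (t₁ ω / √(r * (m - 2 * k)) +
            √(1 + t₁ ω ^ 2 / (m - 2 * k)) * (t₂ ω / √(m - 2 * k + 1)))))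
      (predictiveWealth x prior W rf v) P := by
  let f : ℝ × ℝ → ℝ := fun p => W * (1 + rf + v ⬝ᵥ (c - fun _ => rf) + √(v ⬝ᵥ (S *ᵥ v)) *
    (p.1 / √(r * (m - 2 * k)) + √(1 + p.1 ^ 2 / (m - 2 * k)) * (p.2 / √(m - 2 * k + 1))))
  have hf : Measurable f := by fun_prop
  have hm₁ := h₁.aemeasurable
  have hm₂ := h₂.aemeasurable
  have hpair : P.map (fun ω => (t₁ ω, t₂ ω)) =
      (studentT (m - 2 * k)).prod (studentT (m - 2 * k + 1)) := by
    rw [(indepFun_iff_map_prod_eq_prod_map_map hm₁ hm₂).mp hind, h₁.map_eq, h₂.map_eq]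
  have hs₁ : IsProbabilityMeasure (studentT (m - 2 * (k : ℝ))) := by
    rw [← h₁.map_eq]; exact Measure.isProbabilityMeasure_map hm₁
  have hs₂ : IsProbabilityMeasure (studentT (m - 2 * (k : ℝ) + 1)) := by
    rw [← h₂.map_eq]; exact Measure.isProbabilityMeasure_map hm₂
  refine ⟨hf.comp_aemeasurable (hm₁.prodMk hm₂), ?_⟩
  refine Measure.ext_of_lintegral _ fun F hF => ?_
  rw [lintegral_predictiveWealth hm hS hC hr h W rf v hF]
  change ∫⁻ w, F w ∂(P.map (f ∘ fun ω => (t₁ ω, t₂ ω))) = _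
  rw [← AEMeasurable.map_map_of_aemeasurable hf.aemeasurable (hm₁.prodMk hm₂), hpair,
    lintegral_map hF hf, lintegral_prod _ (by fun_prop)]

end

/-! ### Likelihood and priors -/

lemma normalDensity_inv_smul (c : Fin k → ℝ) {r : ℝ} (hr : 0 < r)
    {S : Matrix (Fin k) (Fin k) ℝ} (hS : S.PosDef) (y : Fin k → ℝ) :
    normalDensity c (r⁻¹ • S) y =
      (2 * Real.pi) ^ (-(k : ℝ) / 2) * (r⁻¹ ^ k) ^ (-(1 : ℝ) / 2) * S.det ^ (-(1 : ℝ) / 2) *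
        Real.exp (-(1 / 2) * (r * ((y - c) ⬝ᵥ (S⁻¹ *ᵥ (y - c))))) := by
  have h1 : (r⁻¹ • S)⁻¹ = r • S⁻¹ := by
    apply Matrix.inv_eq_right_inv
    rw [Matrix.smul_mul, Matrix.mul_smul, Matrix.mul_nonsing_inv _ hS.det_pos.ne'.isUnit,
      smul_smul, inv_mul_cancel₀ hr.ne', one_smul]
  rw [normalDensity, h1, Matrix.det_smul, Fintype.card_fin,
    Real.mul_rpow (by positivity) hS.det_pos.le, Matrix.smul_mulVec, dotProduct_smul, smul_eq_mul,
    ← mul_assoc]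

lemma sum_sub_sampleMean (hn : 0 < n) (x : Fin n → Fin k → ℝ) :
    ∑ i, (x i - sampleMean x) = 0 := by
  have : (n : ℝ) ≠ 0 := by positivity
  rw [Finset.sum_sub_distrib, Finset.sum_const, Finset.card_univ, Fintype.card_fin, sampleMean,
    ← Nat.cast_smul_eq_nsmul ℝ, smul_smul, mul_inv_cancel₀ this, one_smul, sub_self]

lemma diffuseScale_eq_sum (x : Fin n → Fin k → ℝ) :
    diffuseScale x = ∑ i, Matrix.vecMulVec (x i - sampleMean x) (x i - sampleMean x) := by
  -- For `n = 1` the factor `(n - 1)⁻¹` is `0⁻¹ = 0`, but the only deviation from the sample mean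
  -- vanishes too.
  by_cases hn : n = 1
  · subst hn
    have h := sum_sub_sampleMean one_pos x
    rw [Fin.sum_univ_one] at h
    simp [diffuseScale, h]
  · have : (n : ℝ) - 1 ≠ 0 := sub_ne_zero.mpr (by exact_mod_cast hn)
    rw [diffuseScale, sampleCov, smul_smul, mul_inv_cancel₀ this, one_smul]

lemma posSemidef_vecMulVec_self (a : Fin k → ℝ) : (Matrix.vecMulVec a a).PosSemidef := by
  simpa using Matrix.posSemidef_vecMulVec_self_star a

lemma posSemidef_diffuseScale (x : Fin n → Fin k → ℝ) : (diffuseScale x).PosSemidef := by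
  rw [diffuseScale_eq_sum]
  exact Matrix.posSemidef_sum _ fun i _ => posSemidef_vecMulVec_self _

lemma trace_mul_vecMulVec (M : Matrix (Fin k) (Fin k) ℝ) (a : Fin k → ℝ) :
    (M * Matrix.vecMulVec a a).trace = a ⬝ᵥ (M *ᵥ a) := by
  rw [Matrix.mul_vecMulVec, Matrix.trace_vecMulVec, dotProduct_comm]

lemma quadForm_add (M : Matrix (Fin k) (Fin k) ℝ) (a b : Fin k → ℝ) :
    (a + b) ⬝ᵥ (M *ᵥ (a + b)) =
      a ⬝ᵥ (M *ᵥ a) + a ⬝ᵥ (M *ᵥ b) + b ⬝ᵥ (M *ᵥ a) + b ⬝ᵥ (M *ᵥ b) := by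
  rw [Matrix.mulVec_add, dotProduct_add, add_dotProduct, add_dotProduct]
  ring

/-- The decomposition of the sum of squares around the sample mean. -/
lemma sum_quadForm_sub (hn : 0 < n) (x : Fin n → Fin k → ℝ) (M : Matrix (Fin k) (Fin k) ℝ)
    (μ : Fin k → ℝ) :
    ∑ i, (x i - μ) ⬝ᵥ (M *ᵥ (x i - μ)) =
      (M * diffuseScale x).trace +
        n * ((μ - sampleMean x) ⬝ᵥ (M *ᵥ (μ - sampleMean x))) := by
  have h0 := sum_sub_sampleMean hn x
  have h1 : ∀ i, (x i - μ) ⬝ᵥ (M *ᵥ (x i - μ)) =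
      (x i - sampleMean x) ⬝ᵥ (M *ᵥ (x i - sampleMean x)) +
      (x i - sampleMean x) ⬝ᵥ (M *ᵥ (sampleMean x - μ)) +
      (sampleMean x - μ) ⬝ᵥ (M *ᵥ (x i - sampleMean x)) +
      (sampleMean x - μ) ⬝ᵥ (M *ᵥ (sampleMean x - μ)) := fun i => by
    rw [← quadForm_add, sub_add_sub_cancel]
  have h2 : (sampleMean x - μ) ⬝ᵥ (M *ᵥ (sampleMean x - μ)) =
      (μ - sampleMean x) ⬝ᵥ (M *ᵥ (μ - sampleMean x)) := by
    rw [← neg_sub μ, Matrix.mulVec_neg, neg_dotProduct_neg]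
  simp only [h1, Finset.sum_add_distrib]
  rw [← sum_dotProduct, ← dotProduct_sum, ← Matrix.mulVec_sum, h0, zero_dotProduct,
    Matrix.mulVec_zero, dotProduct_zero, diffuseScale_eq_sum, Matrix.mul_sum, Matrix.trace_sum,
    Finset.sum_const, Finset.card_univ, Fintype.card_fin, nsmul_eq_mul, h2]
  simp only [trace_mul_vecMulVec, add_zero]

lemma likelihood_eq (hn : 0 < n) (x : Fin n → Fin k → ℝ) (μ : Fin k → ℝ)
    {S : Matrix (Fin k) (Fin k) ℝ} (hS : S.PosDef) :
    likelihood x μ S = ((2 * Real.pi) ^ (-(k : ℝ) / 2)) ^ n * S.det ^ (-(n : ℝ) / 2) *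
      Real.exp (-(1 / 2) * ((S⁻¹ * diffuseScale x).trace +
        n * ((μ - sampleMean x) ⬝ᵥ (S⁻¹ *ᵥ (μ - sampleMean x))))) := by
  simp only [likelihood, normalDensity]
  rw [Finset.prod_mul_distrib, ← Real.exp_sum, Finset.prod_const, Finset.card_univ,
    Fintype.card_fin, ← Finset.mul_sum, sum_quadForm_sub hn, mul_pow,
    ← Real.rpow_natCast (S.det ^ _), ← Real.rpow_mul hS.det_pos.le]
  congr 3
  ring

/-- The determinant exponents add up to `-(n + k + 1)/2`. A share `-1/2` belongs to the normal
density of `μ`, which leaves `m = n + k`. -/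
lemma likelihood_mul_diffusePrior (hn : 0 < n) (x : Fin n → Fin k → ℝ) :
    ∃ C : ℝ, 0 < C ∧ ∀ μ Sg, Sg.PosDef → likelihood x μ Sg * diffusePrior μ Sg =
      C * (invWishartKernel (n + k) (diffuseScale x) Sg *
        normalDensity (sampleMean x) ((n : ℝ)⁻¹ • Sg) μ) := by
  have hn' : (0 : ℝ) < n := by exact_mod_cast hn
  -- The constant of the likelihood divided by that of the density of `N(x̄, Σ/n)`.
  refine ⟨((2 * Real.pi) ^ (-(k : ℝ) / 2)) ^ n /
    ((2 * Real.pi) ^ (-(k : ℝ) / 2) * ((n : ℝ)⁻¹ ^ k) ^ (-(1 : ℝ) / 2)), by positivity,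
    fun μ Sg hS => ?_⟩
  have hdet : Sg.det ^ (-(n : ℝ) / 2) * Sg.det ^ (-((k : ℝ) + 1) / 2) =
      Sg.det ^ (-((n : ℝ) + k) / 2) * Sg.det ^ (-(1 : ℝ) / 2) := by
    rw [← Real.rpow_add hS.det_pos, ← Real.rpow_add hS.det_pos]
    congr 1; ring
  rw [likelihood_eq hn x μ hS, normalDensity_inv_smul _ hn' hS, diffusePrior, invWishartKernel,
    mul_add, Real.exp_add]
  have hne : (2 * Real.pi) ^ (-(k : ℝ) / 2) * ((n : ℝ)⁻¹ ^ k) ^ (-(1 : ℝ) / 2) ≠ 0 := by positivity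
  generalize (2 * Real.pi) ^ (-(k : ℝ) / 2) * ((n : ℝ)⁻¹ ^ k) ^ (-(1 : ℝ) / 2) = N at hne ⊢
  rw [div_mul_eq_mul_div, eq_div_iff hne]
  linear_combination ((2 * Real.pi) ^ (-(k : ℝ) / 2)) ^ n *
    Real.exp (-(1 / 2) * (Sg⁻¹ * diffuseScale x).trace) *
    Real.exp (-(1 / 2) * (n * ((μ - sampleMean x) ⬝ᵥ (Sg⁻¹ *ᵥ (μ - sampleMean x))))) * N * hdet

/-- Completing the square in the posterior for the conjugate prior. -/
lemma quadForm_conjugate (x : Fin n → Fin k → ℝ) (M : Matrix (Fin k) (Fin k) ℝ)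
    (μ m₀ : Fin k → ℝ) {r₀ : ℝ} (hr : 0 < r₀) (S₀ : Matrix (Fin k) (Fin k) ℝ) :
    (M * diffuseScale x).trace + n * ((μ - sampleMean x) ⬝ᵥ (M *ᵥ (μ - sampleMean x))) +
      r₀ * ((μ - m₀) ⬝ᵥ (M *ᵥ (μ - m₀))) + (M * S₀).trace =
    (M * conjugateScale x m₀ r₀ S₀).trace + (n + r₀) *
      ((μ - conjugateMean x m₀ r₀) ⬝ᵥ (M *ᵥ (μ - conjugateMean x m₀ r₀))) := by
  have hnr : (n : ℝ) + r₀ ≠ 0 := by positivity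
  set a := μ - sampleMean x with ha
  set b := μ - m₀ with hb
  have h1 : μ - conjugateMean x m₀ r₀ = ((n : ℝ) + r₀)⁻¹ • ((n : ℝ) • a + r₀ • b) := by
    ext i
    simp only [conjugateMean, ha, hb, Pi.sub_apply, Pi.smul_apply, Pi.add_apply, smul_eq_mul]
    field_simp
    ring
  have h2 : m₀ - sampleMean x = a + -b := by rw [ha, hb]; abel
  rw [conjugateScale, Matrix.mul_add, Matrix.mul_add, Matrix.trace_add, Matrix.trace_add,
    Matrix.mul_smul, Matrix.trace_smul, trace_mul_vecMulVec, h1, h2, Matrix.mulVec_smul,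
    smul_dotProduct, dotProduct_smul, quadForm_add, quadForm_add]
  simp only [Matrix.mulVec_smul, Matrix.mulVec_neg, smul_dotProduct, dotProduct_smul,
    neg_dotProduct, dotProduct_neg, smul_eq_mul, neg_neg]
  field_simp
  ring

lemma multivariateGamma_pos {a : ℝ} (ha : (k : ℝ) - 1 < 2 * a) : 0 < multivariateGamma k a := by
  refine mul_pos (by positivity) (Finset.prod_pos fun i _ => Real.Gamma_pos_of_pos ?_)
  have : ((i : ℕ) : ℝ) + 1 ≤ k := by exact_mod_cast i.isLt
  linarith

/-- The prior's normal factor already carries the share `-1/2` of the determinant exponent, so `m =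
n + d₀`; the exponentials match by `quadForm_conjugate`. The bound `2k < d₀` makes the prior's
normalizing constant positive. -/
lemma likelihood_mul_conjugatePrior (hn : 0 < n) (x : Fin n → Fin k → ℝ) (m₀ : Fin k → ℝ)
    {r₀ d₀ : ℝ} {S₀ : Matrix (Fin k) (Fin k) ℝ} (hr : 0 < r₀) (hd : 2 * (k : ℝ) < d₀)
    (hS₀ : S₀.PosDef) :
    ∃ C : ℝ, 0 < C ∧ ∀ μ Sg, Sg.PosDef → likelihood x μ Sg * conjugatePrior m₀ r₀ d₀ S₀ μ Sg =
      C * (invWishartKernel (n + d₀) (conjugateScale x m₀ r₀ S₀) Sg *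
        normalDensity (conjugateMean x m₀ r₀) (((n : ℝ) + r₀)⁻¹ • Sg) μ) := by
  have hnr : 0 < (n : ℝ) + r₀ := by positivity
  have hdet₀ := hS₀.det_pos
  have hΓ : 0 < multivariateGamma k ((d₀ - k - 1) / 2) := multivariateGamma_pos (by linarith)
  set K := (2 : ℝ) ^ (-((d₀ - k - 1) * k / 2)) * S₀.det ^ ((d₀ - k - 1) / 2) /
      multivariateGamma k ((d₀ - k - 1) / 2) with hK
  have hK0 : 0 < K := by positivity
  set N := (2 * Real.pi) ^ (-(k : ℝ) / 2) * (((n : ℝ) + r₀)⁻¹ ^ k) ^ (-(1 : ℝ) / 2) with hN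
  have hN0 : 0 < N := by positivity
  clear_value K N
  refine ⟨((2 * Real.pi) ^ (-(k : ℝ) / 2)) ^ n *
    ((2 * Real.pi) ^ (-(k : ℝ) / 2) * (r₀⁻¹ ^ k) ^ (-(1 : ℝ) / 2)) * K / N, by positivity,
    fun μ Sg hS => ?_⟩
  have hdet : Sg.det ^ (-(n : ℝ) / 2) * Sg.det ^ (-d₀ / 2) = Sg.det ^ (-((n : ℝ) + d₀) / 2) := by
    rw [← Real.rpow_add hS.det_pos]
    congr 1; ring
  have hexp := congrArg (fun y => Real.exp (-(1 / 2) * y))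
    (quadForm_conjugate x Sg⁻¹ μ m₀ hr S₀)
  simp only [mul_add (-(1 / 2) : ℝ), Real.exp_add] at hexp
  rw [likelihood_eq hn x μ hS, conjugatePrior, invWishartDensity, ← hK,
    normalDensity_inv_smul _ hr hS, normalDensity_inv_smul _ hnr hS, ← hN, invWishartKernel,
    mul_add, Real.exp_add, div_mul_eq_mul_div, eq_div_iff hN0.ne', ← hdet]
  linear_combination ((2 * Real.pi) ^ (-(k : ℝ) / 2)) ^ n *
    ((2 * Real.pi) ^ (-(k : ℝ) / 2) * (r₀⁻¹ ^ k) ^ (-(1 : ℝ) / 2)) * K * N *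
    Sg.det ^ (-(n : ℝ) / 2) * Sg.det ^ (-d₀ / 2) * Sg.det ^ (-(1 : ℝ) / 2) * hexp

lemma posDef_conjugateScale (x : Fin n → Fin k → ℝ) (m₀ : Fin k → ℝ) {r₀ : ℝ} (hr : 0 < r₀)
    {S₀ : Matrix (Fin k) (Fin k) ℝ} (hS₀ : S₀.PosDef) : (conjugateScale x m₀ r₀ S₀).PosDef :=
  ((hS₀.posSemidef_add (posSemidef_diffuseScale x))).add_posSemidef
    ((posSemidef_vecMulVec_self _).smul (by positivity))

end BayesPortfolio

open BayesPortfolio in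
theorem theorem6 {k n : ℕ} (hkn : k < n) (x : Fin n → Fin k → ℝ)
    (v : Fin k → ℝ) (W rf : ℝ) :
    -- (a) diffuse prior
    ((diffuseScale x).PosDef →
      IsProbabilityMeasure (posterior x diffusePrior) ∧
      ∀ {Ω : Type*} [MeasurableSpace Ω] (P : Measure Ω) [IsProbabilityMeasure P] (t₁ t₂ : Ω → ℝ),
        HasLaw t₁ (studentT ((n : ℝ) - k)) P →
        HasLaw t₂ (studentT ((n : ℝ) - k + 1)) P →
        IndepFun t₁ t₂ P →
        HasLaw (fun ω =>
            W * (1 + rf + v ⬝ᵥ (sampleMean x - fun _ => rf) +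
              √(v ⬝ᵥ (diffuseScale x *ᵥ v)) *
                (t₁ ω / √((n : ℝ) * ((n : ℝ) - k)) +
                  √(1 + t₁ ω ^ 2 / ((n : ℝ) - k)) * (t₂ ω / √((n : ℝ) - k + 1)))))
          (predictiveWealth x diffusePrior W rf v) P) ∧
    -- (b) conjugate prior
    (∀ (m₀ : Fin k → ℝ) (r₀ d₀ : ℝ) (S₀ : Matrix (Fin k) (Fin k) ℝ),
      0 < r₀ → 2 * (k : ℝ) < d₀ → S₀.PosDef →
      IsProbabilityMeasure (posterior x (conjugatePrior m₀ r₀ d₀ S₀)) ∧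
      ∀ {Ω : Type*} [MeasurableSpace Ω] (P : Measure Ω) [IsProbabilityMeasure P] (t₁ t₂ : Ω → ℝ),
        HasLaw t₁ (studentT ((n : ℝ) + d₀ - 2 * k)) P →
        HasLaw t₂ (studentT ((n : ℝ) + d₀ - 2 * k + 1)) P →
        IndepFun t₁ t₂ P →
        HasLaw (fun ω =>
            W * (1 + rf + v ⬝ᵥ (conjugateMean x m₀ r₀ - fun _ => rf) +
              √(v ⬝ᵥ (conjugateScale x m₀ r₀ S₀ *ᵥ v)) *
                (t₁ ω / √(((n : ℝ) + r₀) * ((n : ℝ) + d₀ - 2 * k)) +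
                  √(1 + t₁ ω ^ 2 / ((n : ℝ) + d₀ - 2 * k)) *
                    (t₂ ω / √((n : ℝ) + d₀ - 2 * k + 1)))))
          (predictiveWealth x (conjugatePrior m₀ r₀ d₀ S₀) W rf v) P) := by
  have hn : 0 < n := by omega
  have hkn' : (k : ℝ) < n := by exact_mod_cast hkn
  refine ⟨fun hS => ?_, fun m₀ r₀ d₀ S₀ hr hd hS₀ => ?_⟩
  · obtain ⟨C, hC, h⟩ := likelihood_mul_diffusePrior hn x
    have hm : 2 * (k : ℝ) < n + k := by linarith
    -- With `m = n + k`, the general degrees of freedom `m - 2k` become `n - k`.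
    have hδ : (n : ℝ) + k - 2 * k = n - k := by ring
    have hn' : (0 : ℝ) < n := by exact_mod_cast hn
    refine ⟨isProbabilityMeasure_posterior hm hS hC hn' h, fun P _ t₁ t₂ h₁ h₂ hind => ?_⟩
    rw [← hδ] at h₁ h₂ ⊢
    exact hasLaw_predictiveWealth hm hS hC hn' h W rf v P t₁ t₂ h₁ h₂ hind
  · obtain ⟨C, hC, h⟩ := likelihood_mul_conjugatePrior hn x m₀ hr hd hS₀
    have hm : 2 * (k : ℝ) < n + d₀ := by linarith
    have hS := posDef_conjugateScale x m₀ hr hS₀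
    have hnr : 0 < (n : ℝ) + r₀ := by positivity
    exact ⟨isProbabilityMeasure_posterior hm hS hC hnr h, fun P _ t₁ t₂ h₁ h₂ hind =>
      hasLaw_predictiveWealth hm hS hC hnr h W rf v P t₁ t₂ h₁ h₂ hind⟩
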